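/- For each $n$ let $y_i = x_i'\beta+\varepsilon_i$, $i=1,\dots,n$ (the dependence on $n$ of all quantities is suppressed, and all limits are as $n\to\infty$), where $x_i\in\mathbb{R}^{k}$ and $\beta\in\mathbb{R}^k$ are non-random, $k=k_n$ may vary with $n$, $S_{xx}=\sum_{i=1}^n x_ix_i'$ is invertible, and $\varepsilon_1,\dots,\varepsilon_n$ are independent with $E[\varepsilon_i]=0$ and $E[\varepsilon_i^2]=\sigma_i^2$. Let $A=A_n\in\mathbb{R}^{k\times k}$ be a non-random symmetric matrix of rank $r$, where $r$ does not depend on $n$. Let $\lambda_1,\dots,\lambda_r$, $\lambda_1^2\ge\dots\ge\lambda_r^2$, be the non-zero eigenvalues of $\tilde A=S_{xx}^{-1/2}AS_{xx}^{-1/2}$, and let $Q\in\mathbb{R}^{k\times r}$ have the corresponding orthonormal eigenvectors as columns, so that $\tilde A=Q\,\mathrm{diag}(\lambda_1,\dots,\lambda_r)\,Q'$. Put $$w_i=Q'S_{xx}^{-1/2}x_i,\quad b=Q'S_{xx}^{1/2}\beta,\quad \hat b=\sum_{i=1}^n w_iy_i,\quad P_{ii}=x_i'S_{xx}^{-1}x_i,\quad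 B_{ii}=x_i'S_{xx}^{-1}AS_{xx}^{-1}x_i,$$ $$\hat\beta=S_{xx}^{-1}\sum_{i=1}^n x_iy_i,\quad \hat\beta_{-i}=(S_{xx}-x_ix_i')^{-1}\sum_{\ell\ne i}x_\ell y_\ell,\quad \hat\sigma_i^2=y_i(y_i-x_i'\hat\beta_{-i}),$$ $$\hat\theta=\hat\beta'A\hat\beta-\sum_{i=1}^nB_{ii}\hat\sigma_i^2,\quad \hat{\mathbb V}[\hat b]=\sum_{i=1}^n w_iw_i'\hat\sigma_i^2,\quad \hat{\mathbb V}[\hat\beta]=S_{xx}^{-1}\Big(\sum_{i=1}^n x_ix_i'\hat\sigma_i^2\Big)S_{xx}^{-1}.$$ Assume that (i) $\max_i(E[\varepsilon_i^4]+\sigma_i^{-2})=O(1)$; (ii) there is a constant $c<1$ such that $\max_iP_{ii}\le c$ for all sufficiently large $n$; (iii) $\max_i(x_i'\beta)^2=O(1)$; and that $\max_iw_i'w_i=o(1)$. Then 1. $\mathbb V[\hat b]^{-1/2}(\hat b-b)\xrightarrow{d}\mathcal N(0,I_r)$; 2. $\mathbb V[\hat b]^{-1}\hat{\mathbb V}[\hat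 b]\xrightarrow{p}I_r$; 3. $\hat\theta=\sum_{\ell=1}^r\lambda_\ell(\hat b_\ell^2-\mathbb V[\hat b_\ell])+o_p(\mathbb V[\hat\theta]^{1/2})$. In particular, if $A=vv'$ for non-random $v=v_n\in\mathbb{R}^k$ with $v\neq0$, then $$\frac{v'(\hat\beta-\beta)}{\sqrt{v'\hat{\mathbb V}[\hat\beta]v}}\xrightarrow{d}\mathcal N(0,1).$$ -/

import Mathlib

open MeasureTheory ProbabilityTheory Filter Topology Matrix
open scoped MatrixOrder

noncomputable section

namespace LeaveOut

/-- The design matrix `S_xx = ∑ᵢ xᵢ xᵢ'`. -/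
def Sxx {n k : ℕ} (x : Fin n → Fin k → ℝ) : Matrix (Fin k) (Fin k) ℝ :=
  ∑ i, vecMulVec (x i) (x i)

/-- The positive semidefinite square root `S_xx^{1/2}`. -/
def SxxHalf {n k : ℕ} (x : Fin n → Fin k → ℝ) : Matrix (Fin k) (Fin k) ℝ :=
  CFC.sqrt (Sxx x)

/-- The leverage `P_ii = xᵢ' S_xx⁻¹ xᵢ`. -/
def leverage {n k : ℕ} (x : Fin n → Fin k → ℝ) (i : Fin n) : ℝ :=
  x i ⬝ᵥ ((Sxx x)⁻¹ *ᵥ x i)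

/-- The OLS estimator `β̂ = S_xx⁻¹ ∑ᵢ xᵢ yᵢ`. -/
def betaHat {n k : ℕ} (x : Fin n → Fin k → ℝ) (y : Fin n → ℝ) : Fin k → ℝ :=
  (Sxx x)⁻¹ *ᵥ ∑ i, y i • x i

/-- The leave-`i`-out OLS estimator `β̂₋ᵢ = (S_xx - xᵢ xᵢ')⁻¹ ∑_{l ≠ i} x_l y_l`. -/
def betaHatLeaveOut {n k : ℕ} (x : Fin n → Fin k → ℝ) (y : Fin n → ℝ) (i : Fin n) :
    Fin k → ℝ :=
  (Sxx x - vecMulVec (x i) (x i))⁻¹ *ᵥ ∑ l ∈ Finset.univ.erase i, y l • x l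

/-- The leave-out estimator `σ̂ᵢ² = yᵢ (yᵢ - xᵢ' β̂₋ᵢ)` of the `i`-th error variance. -/
def sigmaSqHat {n k : ℕ} (x : Fin n → Fin k → ℝ) (y : Fin n → ℝ) (i : Fin n) : ℝ :=
  y i * (y i - x i ⬝ᵥ betaHatLeaveOut x y i)

/-- `B_ii = xᵢ' S_xx⁻¹ A S_xx⁻¹ xᵢ`. -/
def Bdiag {n k : ℕ} (x : Fin n → Fin k → ℝ) (A : Matrix (Fin k) (Fin k) ℝ) (i : Fin n) : ℝ :=
  x i ⬝ᵥ (((Sxx x)⁻¹ * A * (Sxx x)⁻¹) *ᵥ x i)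

/-- The leave-out estimator `θ̂ = β̂' A β̂ - ∑ᵢ B_ii σ̂ᵢ²` of `θ = β' A β`. -/
def thetaHat {n k : ℕ} (x : Fin n → Fin k → ℝ) (A : Matrix (Fin k) (Fin k) ℝ)
    (y : Fin n → ℝ) : ℝ :=
  betaHat x y ⬝ᵥ (A *ᵥ betaHat x y) - ∑ i, Bdiag x A i * sigmaSqHat x y i

/-- `Ã = S_xx^{-1/2} A S_xx^{-1/2}`. -/
def Atilde {n k : ℕ} (x : Fin n → Fin k → ℝ) (A : Matrix (Fin k) (Fin k) ℝ) :
    Matrix (Fin k) (Fin k) ℝ :=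
  (SxxHalf x)⁻¹ * A * (SxxHalf x)⁻¹

/-- `M = Q diag(lam) Q'`, where the columns of `Q` are orthonormal eigenvectors of `M` for the
non-zero eigenvalues `lam 0, …, lam (r-1)` of `M`, listed with multiplicity and ordered so that
their squares decrease. -/
structure IsSpectralDecomposition {k r : ℕ} (M : Matrix (Fin k) (Fin k) ℝ)
    (Q : Matrix (Fin k) (Fin r) ℝ) (lam : Fin r → ℝ) : Prop where
  orthonormal : Qᵀ * Q = 1
  eq_mul : M = Q * diagonal lam * Qᵀ
  ne_zero : ∀ l, lam l ≠ 0
  antitone_sq : Antitone fun l => lam l ^ 2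

/-- `wᵢ = Q' S_xx^{-1/2} xᵢ`. -/
def w {n k r : ℕ} (x : Fin n → Fin k → ℝ) (Q : Matrix (Fin k) (Fin r) ℝ) (i : Fin n) :
    Fin r → ℝ :=
  Qᵀ *ᵥ ((SxxHalf x)⁻¹ *ᵥ x i)

/-- `b = Q' S_xx^{1/2} β`. -/
def b {n k r : ℕ} (x : Fin n → Fin k → ℝ) (Q : Matrix (Fin k) (Fin r) ℝ) (β : Fin k → ℝ) :
    Fin r → ℝ :=
  Qᵀ *ᵥ (SxxHalf x *ᵥ β)

/-- `b̂ = ∑ᵢ wᵢ yᵢ` (which equals `Q' S_xx^{1/2} β̂`). -/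
def bHat {n k r : ℕ} (x : Fin n → Fin k → ℝ) (Q : Matrix (Fin k) (Fin r) ℝ) (y : Fin n → ℝ) :
    Fin r → ℝ :=
  ∑ i, y i • w x Q i

/-- The leave-out variance estimator `V̂[b̂] = ∑ᵢ wᵢ wᵢ' σ̂ᵢ²`. -/
def varHatB {n k r : ℕ} (x : Fin n → Fin k → ℝ) (Q : Matrix (Fin k) (Fin r) ℝ)
    (y : Fin n → ℝ) : Matrix (Fin r) (Fin r) ℝ :=
  ∑ i, sigmaSqHat x y i • vecMulVec (w x Q i) (w x Q i)

/-- The leave-out variance estimator `V̂[β̂] = S_xx⁻¹ (∑ᵢ xᵢ xᵢ' σ̂ᵢ²) S_xx⁻¹`. -/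
def varHatBeta {n k : ℕ} (x : Fin n → Fin k → ℝ) (y : Fin n → ℝ) : Matrix (Fin k) (Fin k) ℝ :=
  (Sxx x)⁻¹ * (∑ i, sigmaSqHat x y i • vecMulVec (x i) (x i)) * (Sxx x)⁻¹

/-- The variance matrix `V[Z]` of a random vector `Z`. -/
def varMatrix {Ω : Type*} [MeasurableSpace Ω] (μ : Measure Ω) {r : ℕ} (Z : Ω → Fin r → ℝ) :
    Matrix (Fin r) (Fin r) ℝ :=
  Matrix.of fun l m => cov[fun ω => Z ω l, fun ω => Z ω m; μ]

end LeaveOut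

end

/-! Write mᵢ = xᵢ'β, P = `hatMatrix x` and K = `looWeight x`. A rank-one downdate of S_xx shows that
leaving out i divides the off-diagonal entries of row i of P by 1 - Pᵢᵢ. Since P fixes the signal,
σ̂ᵢ² = (mᵢ + εᵢ)(εᵢ - ∑ⱼ Kᵢⱼ εⱼ), and K has zero diagonal, so σ̂ᵢ² is unbiased for σᵢ². Leverages
bounded away from 1 bound the rows and the operator norm of K, whence E[(∑ gᵢ(σ̂ᵢ² - σᵢ²))²] ≤ M ∑
gᵢ² for every choice of weights (`integral_sum_estimate_sub_sq_le`). A single σ̂ᵢ² need not be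
consistent, but a weighted sum with small ∑ gᵢ² is.

The smallness comes from ∑ wᵢwᵢ' = I: it gives ∑ (wᵢ'wᵢ)² ≤ r max wᵢ'wᵢ → 0, and, variances being
bounded below, V[b̂] ≥ C⁻¹ I.

Claim 1: the weights of a standardized linear form are O((max wᵢ'wᵢ)^{1/2}) uniformly, so a
characteristic function expansion with third moments yields normality
(`tendstoInDistribution_of_inner_eq_linear`). Claim 2: the entries of V[b̂]⁻¹V̂[b̂] - I are weighted
sums as above, with ∑ gᵢ² ≤ C² r max wᵢ'wᵢ. Claim 3: the remainder is exactly -∑ Bᵢᵢ(σ̂ᵢ² - σᵢ²),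
whose second moment is o(∑ λ²) because Bᵢᵢ² ≤ (∑ λ²)(wᵢ'wᵢ)². In turn V[θ̂] is at least a constant
times ∑ λ², the squared Frobenius norm of the quadratic form, since removing the diagonal costs only
∑ Bᵢᵢ² (`le_variance_quadratic_sub_estimate`). The contrast is the rank-one case: claims 1 and 2 are
rerun for the scalar weights aᵢ = xᵢ'S_xx⁻¹v, and Slutsky's theorem studentizes. -/

noncomputable section

namespace LeaveOut

/-! ### Hat matrix and leave-one-out algebra -/

section LinearAlgebra

variable {n k r : ℕ} {x : Fin n → Fin k → ℝ}

lemma Sxx_eq_mul (x : Fin n → Fin k → ℝ) : Sxx x = (of x)ᵀ * of x := by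
  ext a b
  simp [Sxx, Matrix.sum_apply, vecMulVec_apply, mul_apply]

lemma sum_smul_eq_transpose_mulVec (x : Fin n → Fin k → ℝ) (y : Fin n → ℝ) :
    ∑ i, y i • x i = (of x)ᵀ *ᵥ y := by
  ext a
  simp [mulVec, dotProduct, Finset.sum_apply, mul_comm]

lemma posSemidef_Sxx (x : Fin n → Fin k → ℝ) : (Sxx x).PosSemidef := by
  rw [Sxx_eq_mul, ← conjTranspose_eq_transpose_of_trivial]
  exact posSemidef_conjTranspose_mul_self _

lemma Sxx_transpose (x : Fin n → Fin k → ℝ) : (Sxx x)ᵀ = Sxx x := by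
  simp [Sxx_eq_mul]

lemma Sxx_inv_transpose (x : Fin n → Fin k → ℝ) : ((Sxx x)⁻¹)ᵀ = (Sxx x)⁻¹ := by
  rw [transpose_nonsing_inv, Sxx_transpose]

/-- The projection `X S_xx⁻¹ X'` onto the column space of the design. -/
def hatMatrix (x : Fin n → Fin k → ℝ) : Matrix (Fin n) (Fin n) ℝ :=
  of x * (Sxx x)⁻¹ * (of x)ᵀ

lemma hatMatrix_apply (x : Fin n → Fin k → ℝ) (i j : Fin n) :
    hatMatrix x i j = x i ⬝ᵥ ((Sxx x)⁻¹ *ᵥ x j) := by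
  rw [dotProduct_mulVec]
  simp only [hatMatrix, mul_apply, dotProduct, vecMul, transpose_apply, of_apply]

lemma leverage_eq (x : Fin n → Fin k → ℝ) (i : Fin n) : leverage x i = hatMatrix x i i :=
  (hatMatrix_apply x i i).symm

lemma hatMatrix_transpose (x : Fin n → Fin k → ℝ) : (hatMatrix x)ᵀ = hatMatrix x := by
  simp [hatMatrix, transpose_mul, Sxx_inv_transpose, Matrix.mul_assoc]

lemma hatMatrix_comm (x : Fin n → Fin k → ℝ) (i j : Fin n) :
    hatMatrix x i j = hatMatrix x j i := by
  conv_lhs => rw [← hatMatrix_transpose]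
  rfl

lemma hatMatrix_mul_design (hS : IsUnit (Sxx x)) : hatMatrix x * of x = of x := by
  have h := (isUnit_iff_isUnit_det _).1 hS
  rw [hatMatrix, Matrix.mul_assoc, ← Sxx_eq_mul, Matrix.mul_assoc, nonsing_inv_mul _ h,
    Matrix.mul_one]

lemma hatMatrix_mul_self (hS : IsUnit (Sxx x)) : hatMatrix x * hatMatrix x = hatMatrix x := by
  conv_lhs => rhs; rw [hatMatrix]
  rw [← Matrix.mul_assoc, ← Matrix.mul_assoc, hatMatrix_mul_design hS]
  rfl

lemma sum_hatMatrix_mul_signal (hS : IsUnit (Sxx x)) (β : Fin k → ℝ) (i : Fin n) :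
    ∑ j, hatMatrix x i j * (x j ⬝ᵥ β) = x i ⬝ᵥ β := by
  have h := congrFun (congrArg (· *ᵥ β) (hatMatrix_mul_design hS)) i
  simp only [← mulVec_mulVec] at h
  exact h

lemma sum_hatMatrix_sq (hS : IsUnit (Sxx x)) (i : Fin n) :
    ∑ j, hatMatrix x i j ^ 2 = hatMatrix x i i := by
  conv_rhs => rw [← hatMatrix_mul_self hS, mul_apply]
  exact Finset.sum_congr rfl fun j _ => by rw [hatMatrix_comm x j i, sq]

/-- An orthogonal projection is a contraction: the image p of d satisfies |p|² = ⟨p, d⟩, and |d -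
p|² ≥ 0 then gives the bound. -/
lemma sum_sq_sum_mul_hatMatrix_le (hS : IsUnit (Sxx x)) (d : Fin n → ℝ) :
    ∑ j, (∑ i, d i * hatMatrix x i j) ^ 2 ≤ ∑ i, d i ^ 2 := by
  set p : Fin n → ℝ := d ᵥ* hatMatrix x with hp
  have h1 : p ⬝ᵥ p = p ⬝ᵥ d := by
    conv_lhs => rhs; rw [hp, ← hatMatrix_transpose, vecMul_transpose]
    rw [dotProduct_mulVec, hp, vecMul_vecMul, hatMatrix_mul_self hS]
  have h2 : ∑ j, (∑ i, d i * hatMatrix x i j) ^ 2 = p ⬝ᵥ p := by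
    simp [hp, vecMul, dotProduct, sq]
  have h3 : ∑ i, d i ^ 2 = d ⬝ᵥ d := by simp [dotProduct, sq]
  have h4 : 0 ≤ (d - p) ⬝ᵥ (d - p) := by
    simpa using dotProduct_star_self_nonneg (d - p)
  rw [sub_dotProduct, dotProduct_sub, dotProduct_sub, dotProduct_comm d p, h1] at h4
  rw [h2, h3, h1]
  linarith

/-- The weight of `εⱼ` in the leave-`i`-out prediction of `yᵢ`. -/
def looWeight (x : Fin n → Fin k → ℝ) (i j : Fin n) : ℝ :=
  if i = j then 0 else hatMatrix x i j / (1 - hatMatrix x i i)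

@[simp]
lemma looWeight_self (x : Fin n → Fin k → ℝ) (i : Fin n) : looWeight x i i = 0 := by
  simp [looWeight]

/-- The Sherman–Morrison formula for deleting one observation. It also shows that the leave-out
design is invertible as soon as the leverage differs from 1. -/
lemma sub_vecMulVec_mul_eq_one (hS : IsUnit (Sxx x)) {i : Fin n} (hi : hatMatrix x i i ≠ 1) :
    (Sxx x - vecMulVec (x i) (x i)) * ((Sxx x)⁻¹ + (1 - hatMatrix x i i)⁻¹ •
      vecMulVec ((Sxx x)⁻¹ *ᵥ x i) ((Sxx x)⁻¹ *ᵥ x i)) = 1 := by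
  have h := (isUnit_iff_isUnit_det _).1 hS
  have hne : 1 - hatMatrix x i i ≠ 0 := sub_ne_zero.2 hi.symm
  have e1 : vecMulVec (x i) (x i) * (Sxx x)⁻¹ = vecMulVec (x i) ((Sxx x)⁻¹ *ᵥ x i) := by
    rw [vecMulVec_mul, ← mulVec_transpose, Sxx_inv_transpose]
  have e2 : Sxx x * vecMulVec ((Sxx x)⁻¹ *ᵥ x i) ((Sxx x)⁻¹ *ᵥ x i) =
      vecMulVec (x i) ((Sxx x)⁻¹ *ᵥ x i) := by
    rw [mul_vecMulVec, mulVec_mulVec, mul_nonsing_inv _ h, one_mulVec]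
  have e3 : vecMulVec (x i) (x i) * vecMulVec ((Sxx x)⁻¹ *ᵥ x i) ((Sxx x)⁻¹ *ᵥ x i) =
      hatMatrix x i i • vecMulVec (x i) ((Sxx x)⁻¹ *ᵥ x i) := by
    rw [vecMulVec_mul_vecMulVec, ← hatMatrix_apply]
    ext a b
    simp only [vecMulVec_apply, Matrix.smul_apply, Pi.smul_apply, smul_eq_mul]
    ring
  rw [Matrix.sub_mul, Matrix.mul_add, Matrix.mul_add, Matrix.mul_smul, Matrix.mul_smul, e1, e2, e3,
    mul_nonsing_inv _ h]
  ext a b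
  simp only [Matrix.sub_apply, Matrix.add_apply, Matrix.smul_apply, smul_eq_mul]
  field_simp
  ring

/-- With q = ∑_{l ≠ i} Pᵢₗ yₗ, Sherman–Morrison gives q + Pᵢᵢ q / (1 - Pᵢᵢ) = q / (1 - Pᵢᵢ). -/
lemma dotProduct_betaHatLeaveOut (hS : IsUnit (Sxx x)) (y : Fin n → ℝ) {i : Fin n}
    (hi : hatMatrix x i i ≠ 1) :
    x i ⬝ᵥ betaHatLeaveOut x y i = ∑ l, looWeight x i l * y l := by
  have hne : 1 - hatMatrix x i i ≠ 0 := sub_ne_zero.2 hi.symm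
  set u := ∑ l ∈ Finset.univ.erase i, y l • x l with hu
  have hq : x i ⬝ᵥ ((Sxx x)⁻¹ *ᵥ u) = ∑ l ∈ Finset.univ.erase i, hatMatrix x i l * y l := by
    rw [hu, mulVec_sum, dotProduct_sum]
    exact Finset.sum_congr rfl fun l _ => by
      rw [mulVec_smul, dotProduct_smul, hatMatrix_apply, smul_eq_mul, mul_comm]
  have hq' : ((Sxx x)⁻¹ *ᵥ x i) ⬝ᵥ u = x i ⬝ᵥ ((Sxx x)⁻¹ *ᵥ u) := by
    rw [dotProduct_mulVec, ← mulVec_transpose, Sxx_inv_transpose]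
  rw [betaHatLeaveOut, inv_eq_right_inv (sub_vecMulVec_mul_eq_one hS hi), ← hu, add_mulVec,
    dotProduct_add, smul_mulVec, dotProduct_smul, vecMulVec_mulVec, hq', op_smul_eq_smul,
    dotProduct_smul, ← hatMatrix_apply, hq]
  have hsum : ∑ l, looWeight x i l * y l =
      (∑ l ∈ Finset.univ.erase i, hatMatrix x i l * y l) / (1 - hatMatrix x i i) := by
    rw [← Finset.add_sum_erase _ _ (Finset.mem_univ i), looWeight_self, zero_mul, zero_add,
      Finset.sum_div]
    refine Finset.sum_congr rfl fun l hl => ?_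
    rw [looWeight, if_neg (Finset.ne_of_mem_erase hl).symm]
    ring
  rw [hsum]
  simp only [smul_eq_mul]
  field_simp
  ring

/-- Noiseless data are predicted exactly. Since P fixes the signal, its off-diagonal part
contributes (1 - Pᵢᵢ) mᵢ, which the denominator of the weights restores to mᵢ. -/
lemma sum_looWeight_mul_signal (hS : IsUnit (Sxx x)) (β : Fin k → ℝ) {i : Fin n}
    (hi : hatMatrix x i i ≠ 1) : ∑ l, looWeight x i l * (x l ⬝ᵥ β) = x i ⬝ᵥ β := by
  have hne : 1 - hatMatrix x i i ≠ 0 := sub_ne_zero.2 hi.symm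
  have h := sum_hatMatrix_mul_signal hS β i
  rw [← Finset.add_sum_erase _ _ (Finset.mem_univ i)] at h ⊢
  rw [looWeight_self, zero_mul, zero_add]
  have : ∑ l ∈ Finset.univ.erase i, looWeight x i l * (x l ⬝ᵥ β) =
      (∑ l ∈ Finset.univ.erase i, hatMatrix x i l * (x l ⬝ᵥ β)) / (1 - hatMatrix x i i) := by
    rw [Finset.sum_div]
    refine Finset.sum_congr rfl fun l hl => ?_
    rw [looWeight, if_neg (Finset.ne_of_mem_erase hl).symm]
    ring
  rw [this, eq_sub_of_add_eq' h]
  field_simp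

lemma sigmaSqHat_eq (hS : IsUnit (Sxx x)) (β : Fin k → ℝ) {y e : Fin n → ℝ}
    (hy : ∀ i, y i = x i ⬝ᵥ β + e i) {i : Fin n} (hi : hatMatrix x i i ≠ 1) :
    sigmaSqHat x y i = (x i ⬝ᵥ β + e i) * (e i - ∑ l, looWeight x i l * e l) := by
  rw [sigmaSqHat, dotProduct_betaHatLeaveOut hS y hi]
  simp_rw [hy, mul_add, Finset.sum_add_distrib, sum_looWeight_mul_signal hS β hi]
  ring

lemma hatMatrix_nonneg (hS : IsUnit (Sxx x)) (i : Fin n) : 0 ≤ hatMatrix x i i := by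
  rw [← sum_hatMatrix_sq hS]
  positivity

lemma sum_looWeight_sq_le (hS : IsUnit (Sxx x)) {c : ℝ} (hc : c < 1) {i : Fin n}
    (hi : hatMatrix x i i ≤ c) : ∑ j, looWeight x i j ^ 2 ≤ ((1 - c)⁻¹) ^ 2 := by
  have h0 : 0 < 1 - hatMatrix x i i := by linarith
  have h1 : ∀ j, looWeight x i j ^ 2 ≤ hatMatrix x i j ^ 2 * ((1 - c)⁻¹) ^ 2 := by
    intro j
    rw [looWeight]
    split_ifs
    · rw [zero_pow two_ne_zero]
      positivity
    · rw [div_eq_mul_inv, mul_pow]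
      have : (1 - hatMatrix x i i)⁻¹ ≤ (1 - c)⁻¹ := inv_anti₀ (by linarith) (by linarith)
      gcongr
  calc ∑ j, looWeight x i j ^ 2 ≤ ∑ j, hatMatrix x i j ^ 2 * ((1 - c)⁻¹) ^ 2 :=
        Finset.sum_le_sum fun j _ => h1 j
    _ = hatMatrix x i i * ((1 - c)⁻¹) ^ 2 := by rw [← Finset.sum_mul, sum_hatMatrix_sq hS]
    _ ≤ 1 * ((1 - c)⁻¹) ^ 2 := by gcongr; linarith
    _ = _ := one_mul _

/-- An operator norm bound for K'. With dᵢ = hᵢ / (1 - Pᵢᵢ) one has K'h = Pd - diag(P)d; both terms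
are contractions of d, and (a - b)² ≤ 2a² + 2b² produces the 4. -/
lemma sum_sq_sum_mul_looWeight_le (hS : IsUnit (Sxx x)) {c : ℝ} (hc : c < 1)
    (hlev : ∀ i, hatMatrix x i i ≤ c) (h : Fin n → ℝ) :
    ∑ j, (∑ i, h i * looWeight x i j) ^ 2 ≤ 4 * ((1 - c)⁻¹) ^ 2 * ∑ i, h i ^ 2 := by
  set d : Fin n → ℝ := fun i => h i / (1 - hatMatrix x i i) with hd
  have hpos : ∀ i, 0 < 1 - hatMatrix x i i := fun i => by linarith [hlev i]
  have hdsq : ∀ i, d i ^ 2 ≤ ((1 - c)⁻¹) ^ 2 * h i ^ 2 := by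
    intro i
    have : (1 - hatMatrix x i i)⁻¹ ≤ (1 - c)⁻¹ := inv_anti₀ (by linarith) (by linarith [hlev i])
    have h0 := inv_pos.2 (hpos i)
    simp only [hd]
    rw [div_eq_mul_inv, mul_pow, mul_comm]
    gcongr
  have key : ∀ j, ∑ i, h i * looWeight x i j = ∑ i, d i * hatMatrix x i j - d j * hatMatrix x j j := by
    intro j
    rw [← Finset.add_sum_erase _ _ (Finset.mem_univ j), looWeight_self, mul_zero, zero_add,
      ← Finset.add_sum_erase Finset.univ (fun i => d i * hatMatrix x i j) (Finset.mem_univ j),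
      add_sub_cancel_left]
    refine Finset.sum_congr rfl fun l hl => ?_
    rw [looWeight, if_neg (Finset.ne_of_mem_erase hl)]
    ring
  have hterm : ∀ j, (∑ i, h i * looWeight x i j) ^ 2 ≤
      2 * (∑ i, d i * hatMatrix x i j) ^ 2 + 2 * d j ^ 2 := by
    intro j
    rw [key]
    have h1 : (d j * hatMatrix x j j) ^ 2 ≤ d j ^ 2 := by
      rw [mul_pow]
      have : hatMatrix x j j ^ 2 ≤ 1 :=
        pow_le_one₀ (hatMatrix_nonneg hS j) (by linarith [hlev j])
      nlinarith [sq_nonneg (d j)]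
    nlinarith [sq_nonneg (∑ i, d i * hatMatrix x i j + d j * hatMatrix x j j)]
  calc ∑ j, (∑ i, h i * looWeight x i j) ^ 2
      ≤ ∑ j, (2 * (∑ i, d i * hatMatrix x i j) ^ 2 + 2 * d j ^ 2) :=
        Finset.sum_le_sum fun j _ => hterm j
    _ = 2 * ∑ j, (∑ i, d i * hatMatrix x i j) ^ 2 + 2 * ∑ j, d j ^ 2 := by
        rw [Finset.sum_add_distrib, Finset.mul_sum, Finset.mul_sum]
    _ ≤ 4 * ∑ j, d j ^ 2 := by linarith [sum_sq_sum_mul_hatMatrix_le hS d]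
    _ ≤ 4 * ∑ i, ((1 - c)⁻¹) ^ 2 * h i ^ 2 := by gcongr with i; exact hdsq i
    _ = _ := by rw [← Finset.mul_sum]; ring

end LinearAlgebra

/-! ### Spectral form of the quadratic form, and the weights wᵢ -/

section Spectral

lemma sqrt_transpose {k : ℕ} (M : Matrix (Fin k) (Fin k) ℝ) :
    (CFC.sqrt M)ᵀ = CFC.sqrt M := by
  have h : (CFC.sqrt M).PosSemidef := nonneg_iff_posSemidef.1 (CFC.sqrt_nonneg M)
  rw [← conjTranspose_eq_transpose_of_trivial]
  exact h.isHermitian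

lemma sqrt_inv_transpose {k : ℕ} (M : Matrix (Fin k) (Fin k) ℝ) :
    ((CFC.sqrt M)⁻¹)ᵀ = (CFC.sqrt M)⁻¹ := by
  rw [transpose_nonsing_inv, sqrt_transpose]

lemma sqrt_mul_sqrt {k : ℕ} {M : Matrix (Fin k) (Fin k) ℝ} (hM : M.PosSemidef) :
    CFC.sqrt M * CFC.sqrt M = M :=
  CFC.sqrt_mul_sqrt_self M (nonneg_iff_posSemidef.2 hM)

lemma isUnit_det_sqrt {k : ℕ} {M : Matrix (Fin k) (Fin k) ℝ} (hM : M.PosSemidef)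
    (hu : IsUnit M) : IsUnit (CFC.sqrt M).det :=
  (isUnit_iff_isUnit_det _).1 ((CFC.isUnit_sqrt_iff M (nonneg_iff_posSemidef.2 hM)).2 hu)

lemma sqrt_inv_mul_self_mul_sqrt_inv {k : ℕ} {M : Matrix (Fin k) (Fin k) ℝ} (hM : M.PosSemidef)
    (hu : IsUnit M) : (CFC.sqrt M)⁻¹ * M * (CFC.sqrt M)⁻¹ = 1 := by
  have h := isUnit_det_sqrt hM hu
  conv_lhs => lhs; rhs; rw [← sqrt_mul_sqrt hM]
  rw [← Matrix.mul_assoc, nonsing_inv_mul _ h, Matrix.one_mul, mul_nonsing_inv _ h]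

variable {n k r : ℕ} {x : Fin n → Fin k → ℝ} {A : Matrix (Fin k) (Fin k) ℝ}
  {Q : Matrix (Fin k) (Fin r) ℝ} {lam : Fin r → ℝ}

/-- The matrix whose rows are the vectors `wᵢ`. -/
def wMatrix (x : Fin n → Fin k → ℝ) (Q : Matrix (Fin k) (Fin r) ℝ) :
    Matrix (Fin n) (Fin r) ℝ :=
  of (w x Q)

lemma wMatrix_eq (x : Fin n → Fin k → ℝ) (Q : Matrix (Fin k) (Fin r) ℝ) :
    wMatrix x Q = of x * (SxxHalf x)⁻¹ * Q := by
  ext i l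
  rw [wMatrix, of_apply, w, mulVec_transpose, ← vecMul_transpose, SxxHalf, sqrt_inv_transpose]
  simp only [mul_apply, vecMul, dotProduct, of_apply]

/-- This is ∑ wᵢwᵢ' = I. The factors S_xx^{-1/2} normalize the design, and Q has orthonormal
columns. -/
lemma wMatrix_transpose_mul_self (hS : IsUnit (Sxx x)) (hQ : Qᵀ * Q = 1) :
    (wMatrix x Q)ᵀ * wMatrix x Q = 1 := by
  have h := sqrt_inv_mul_self_mul_sqrt_inv (posSemidef_Sxx x) hS
  calc (wMatrix x Q)ᵀ * wMatrix x Q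
      = Qᵀ * ((CFC.sqrt (Sxx x))⁻¹ * ((of x)ᵀ * of x) * (CFC.sqrt (Sxx x))⁻¹) * Q := by
        simp only [wMatrix_eq, transpose_mul, SxxHalf, sqrt_inv_transpose, Matrix.mul_assoc]
    _ = 1 := by rw [← Sxx_eq_mul, h, Matrix.mul_one, hQ]

lemma sum_w_mul_w (hS : IsUnit (Sxx x)) (hQ : Qᵀ * Q = 1) (l m : Fin r) :
    ∑ i, w x Q i l * w x Q i m = (1 : Matrix (Fin r) (Fin r) ℝ) l m := by
  rw [← wMatrix_transpose_mul_self hS hQ, mul_apply]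
  rfl

lemma sum_w_dotProduct_self (hS : IsUnit (Sxx x)) (hQ : Qᵀ * Q = 1) :
    ∑ i, w x Q i ⬝ᵥ w x Q i = r := by
  simp only [dotProduct]
  rw [Finset.sum_comm]
  simp [sum_w_mul_w hS hQ]

/-- The matrix of the quadratic form `y ↦ β̂' A β̂`. -/
def Bmatrix (x : Fin n → Fin k → ℝ) (A : Matrix (Fin k) (Fin k) ℝ) : Matrix (Fin n) (Fin n) ℝ :=
  of x * ((Sxx x)⁻¹ * A * (Sxx x)⁻¹) * (of x)ᵀ

lemma Bmatrix_apply (x : Fin n → Fin k → ℝ) (A : Matrix (Fin k) (Fin k) ℝ) (i j : Fin n) :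
    Bmatrix x A i j = x i ⬝ᵥ (((Sxx x)⁻¹ * A * (Sxx x)⁻¹) *ᵥ x j) := by
  rw [dotProduct_mulVec, Bmatrix, mul_apply]
  simp only [dotProduct, vecMul, transpose_apply, of_apply]
  exact Finset.sum_congr rfl fun m _ => by rw [mul_apply]; rfl

lemma Bdiag_eq (x : Fin n → Fin k → ℝ) (A : Matrix (Fin k) (Fin k) ℝ) (i : Fin n) :
    Bdiag x A i = Bmatrix x A i i :=
  (Bmatrix_apply x A i i).symm

lemma Bmatrix_comm (hA : A.IsSymm) (i j : Fin n) : Bmatrix x A i j = Bmatrix x A j i := by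
  have : (Bmatrix x A)ᵀ = Bmatrix x A := by
    simp only [Bmatrix, transpose_mul, Sxx_inv_transpose, transpose_transpose, hA.eq,
      Matrix.mul_assoc]
  conv_lhs => rw [← this]
  rfl

lemma Bmatrix_eq (hS : IsUnit (Sxx x)) (hQ : IsSpectralDecomposition (Atilde x A) Q lam) :
    Bmatrix x A = wMatrix x Q * diagonal lam * (wMatrix x Q)ᵀ := by
  have hu := isUnit_det_sqrt (posSemidef_Sxx x) hS
  have hinv : (Sxx x)⁻¹ = (SxxHalf x)⁻¹ * (SxxHalf x)⁻¹ := by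
    conv_lhs => rw [← sqrt_mul_sqrt (posSemidef_Sxx x)]
    rw [Matrix.mul_inv_rev]
    rfl
  calc Bmatrix x A = of x * (SxxHalf x)⁻¹ * Atilde x A * ((SxxHalf x)⁻¹ * (of x)ᵀ) := by
        simp only [Bmatrix, hinv, Atilde, Matrix.mul_assoc]
    _ = _ := by
        rw [hQ.eq_mul]
        simp only [wMatrix_eq, transpose_mul, SxxHalf, sqrt_inv_transpose, Matrix.mul_assoc]

lemma Bmatrix_apply_eq_sum (hS : IsUnit (Sxx x))
    (hQ : IsSpectralDecomposition (Atilde x A) Q lam) (i j : Fin n) :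
    Bmatrix x A i j = ∑ l, lam l * (w x Q i l * w x Q j l) := by
  rw [Bmatrix_eq hS hQ, mul_apply]
  simp only [mul_diagonal, transpose_apply, wMatrix, of_apply]
  exact Finset.sum_congr rfl fun l _ => by ring

/-- Since B = W diag(λ) W' with W'W = I, the trace of BB' reduces to that of diag(λ)². -/
lemma sum_Bmatrix_sq (hS : IsUnit (Sxx x)) (hQ : IsSpectralDecomposition (Atilde x A) Q lam) :
    ∑ i, ∑ j, Bmatrix x A i j ^ 2 = ∑ l, lam l ^ 2 := by
  have hW := wMatrix_transpose_mul_self hS hQ.orthonormal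
  have h1 : Bmatrix x A * (Bmatrix x A)ᵀ =
      wMatrix x Q * (diagonal lam * diagonal lam * (wMatrix x Q)ᵀ) := by
    rw [Bmatrix_eq hS hQ]
    simp only [transpose_mul, transpose_transpose, diagonal_transpose, Matrix.mul_assoc]
    rw [← Matrix.mul_assoc (wMatrix x Q)ᵀ, hW, Matrix.one_mul]
  have h2 : (Bmatrix x A * (Bmatrix x A)ᵀ).trace = ∑ l, lam l ^ 2 := by
    rw [h1, trace_mul_comm, Matrix.mul_assoc, hW, Matrix.mul_one, diagonal_mul_diagonal,
      trace_diagonal]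
    exact Finset.sum_congr rfl fun l _ => (sq _).symm
  rw [← h2]
  simp only [trace, diag_apply, mul_apply, transpose_apply, sq]

lemma sum_mul_sq_sq_le (lam v : Fin r → ℝ) :
    (∑ l, lam l * (v l * v l)) ^ 2 ≤ (∑ l, lam l ^ 2) * (v ⬝ᵥ v) ^ 2 := by
  refine (Finset.sum_mul_sq_le_sq_mul_sq _ _ _).trans ?_
  gcongr
  simp only [dotProduct]
  exact Finset.sum_sq_le_sq_sum_of_nonneg fun l _ => mul_self_nonneg _

lemma Bdiag_sq_le (hS : IsUnit (Sxx x)) (hQ : IsSpectralDecomposition (Atilde x A) Q lam)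
    (i : Fin n) : Bdiag x A i ^ 2 ≤ (∑ l, lam l ^ 2) * (w x Q i ⬝ᵥ w x Q i) ^ 2 := by
  rw [Bdiag_eq, Bmatrix_apply_eq_sum hS hQ]
  exact sum_mul_sq_sq_le _ _

lemma dotProduct_self_nonneg' (v : Fin r → ℝ) : 0 ≤ v ⬝ᵥ v := by
  simpa using dotProduct_star_self_nonneg v

/-- The squared norms of the wᵢ total r, so a uniform bound makes their sum of squares small. The
negligibility of the variance estimation errors rests on this. -/
lemma sum_w_dotProduct_self_sq_le (hS : IsUnit (Sxx x)) (hQ : Qᵀ * Q = 1) {m : ℝ}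
    (hm : ∀ i, w x Q i ⬝ᵥ w x Q i ≤ m) : ∑ i, (w x Q i ⬝ᵥ w x Q i) ^ 2 ≤ m * r := by
  rw [← sum_w_dotProduct_self hS hQ, Finset.mul_sum]
  refine Finset.sum_le_sum fun i _ => ?_
  rw [sq]
  exact mul_le_mul_of_nonneg_right (hm i) (dotProduct_self_nonneg' _)

lemma sum_Bdiag_sq_le (hS : IsUnit (Sxx x)) (hQ : IsSpectralDecomposition (Atilde x A) Q lam)
    {m : ℝ} (hm : ∀ i, w x Q i ⬝ᵥ w x Q i ≤ m) :
    ∑ i, Bdiag x A i ^ 2 ≤ (∑ l, lam l ^ 2) * (m * r) := by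
  refine (Finset.sum_le_sum fun i _ => Bdiag_sq_le hS hQ i).trans ?_
  rw [← Finset.mul_sum]
  gcongr
  exact sum_w_dotProduct_self_sq_le hS hQ.orthonormal hm

lemma bHat_apply (x : Fin n → Fin k → ℝ) (Q : Matrix (Fin k) (Fin r) ℝ) (y : Fin n → ℝ)
    (l : Fin r) : bHat x Q y l = ∑ i, w x Q i l * y i := by
  simp [bHat, Finset.sum_apply, mul_comm]

lemma bHat_eq_add (hS : IsUnit (Sxx x)) (Q : Matrix (Fin k) (Fin r) ℝ) (β : Fin k → ℝ)
    {y e : Fin n → ℝ} (hy : ∀ i, y i = x i ⬝ᵥ β + e i) (l : Fin r) :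
    bHat x Q y l = b x Q β l + ∑ i, w x Q i l * e i := by
  have hu := isUnit_det_sqrt (posSemidef_Sxx x) hS
  have hb : b x Q β = (wMatrix x Q)ᵀ *ᵥ (of x *ᵥ β) := by
    have h2 : (SxxHalf x)⁻¹ * Sxx x = SxxHalf x := by
      conv_lhs => rw [← sqrt_mul_sqrt (posSemidef_Sxx x)]
      rw [← Matrix.mul_assoc, SxxHalf, nonsing_inv_mul _ hu, Matrix.one_mul]
    have h3 : (wMatrix x Q)ᵀ * of x = Qᵀ * SxxHalf x := by
      rw [← h2, Sxx_eq_mul]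
      simp only [wMatrix_eq, transpose_mul, SxxHalf, sqrt_inv_transpose, Matrix.mul_assoc]
    rw [mulVec_mulVec, h3, b, mulVec_mulVec]
  rw [bHat_apply, hb]
  simp_rw [hy, mul_add, Finset.sum_add_distrib]
  rfl

lemma betaHat_eq (x : Fin n → Fin k → ℝ) (y : Fin n → ℝ) :
    betaHat x y = ((Sxx x)⁻¹ * (of x)ᵀ) *ᵥ y := by
  rw [betaHat, sum_smul_eq_transpose_mulVec, mulVec_mulVec]

lemma betaHat_quadratic (x : Fin n → Fin k → ℝ) (A : Matrix (Fin k) (Fin k) ℝ)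
    (y : Fin n → ℝ) :
    betaHat x y ⬝ᵥ (A *ᵥ betaHat x y) = ∑ i, ∑ j, Bmatrix x A i j * (y i * y j) := by
  have h : betaHat x y ⬝ᵥ (A *ᵥ betaHat x y) = y ⬝ᵥ (Bmatrix x A *ᵥ y) := by
    rw [betaHat_eq]
    conv_lhs => lhs; rw [← vecMul_transpose]
    rw [← dotProduct_mulVec, mulVec_mulVec, mulVec_mulVec]
    simp only [Bmatrix, transpose_mul, Sxx_inv_transpose, transpose_transpose, Matrix.mul_assoc]
  rw [h]
  simp only [dotProduct, mulVec, Finset.mul_sum]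
  exact Finset.sum_congr rfl fun i _ => Finset.sum_congr rfl fun j _ => by ring

lemma betaHat_quadratic_eq_sum (hS : IsUnit (Sxx x))
    (hQ : IsSpectralDecomposition (Atilde x A) Q lam) (y : Fin n → ℝ) :
    betaHat x y ⬝ᵥ (A *ᵥ betaHat x y) = ∑ l, lam l * bHat x Q y l ^ 2 := by
  rw [betaHat_quadratic]
  simp_rw [Bmatrix_apply_eq_sum hS hQ, bHat_apply, sq, Finset.sum_mul_sum, Finset.mul_sum,
    Finset.sum_mul]
  rw [Finset.sum_comm.symm.trans (Finset.sum_congr rfl fun i _ => Finset.sum_comm)]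
  rw [Finset.sum_comm]
  refine Finset.sum_congr rfl fun l _ => ?_
  rw [Finset.sum_comm]
  exact Finset.sum_congr rfl fun i _ => Finset.sum_congr rfl fun j _ => by ring

end Spectral

/-! ### Moments of linear forms and zero-diagonal quadratic forms in the errors -/

section Moments

lemma prod_pow_indicator {Ω : Type*} {n : ℕ} (e : Fin n → Ω → ℝ) (i : Fin n) (ω : Ω) :
    ∏ m, e m ω ^ (if m = i then 1 else 0) = e i ω := by
  simp

variable {Ω : Type*} [MeasurableSpace Ω] {μ : Measure Ω}

/-- Square integrable uncorrelated variables: the covariance of two linear combinations. -/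
lemma integral_sum_mul_sum {ι : Type*} [Fintype ι] {Z : ι → Ω → ℝ} (hZ : ∀ i, MemLp (Z i) 2 μ)
    (h : ∀ i j, i ≠ j → ∫ ω, Z i ω * Z j ω ∂μ = 0) (a b : ι → ℝ) :
    ∫ ω, (∑ i, a i * Z i ω) * (∑ j, b j * Z j ω) ∂μ = ∑ i, a i * b i * ∫ ω, Z i ω ^ 2 ∂μ := by
  classical
  have hint : ∀ i j, Integrable (fun ω => Z i ω * Z j ω) μ := fun i j =>
    (hZ i).integrable_mul (hZ j)
  have e1 : ∀ ω, (∑ i, a i * Z i ω) * (∑ j, b j * Z j ω) =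
      ∑ i, ∑ j, a i * b j * (Z i ω * Z j ω) := fun ω => by
    rw [Finset.sum_mul_sum]
    exact Finset.sum_congr rfl fun i _ => Finset.sum_congr rfl fun j _ => by ring
  simp_rw [e1]
  rw [integral_finsetSum _ fun i _ => integrable_finsetSum _ fun j _ => (hint i j).const_mul _]
  refine Finset.sum_congr rfl fun i _ => ?_
  rw [integral_finsetSum _ fun j _ => (hint i j).const_mul _,
    Finset.sum_eq_single_of_mem i (Finset.mem_univ i)]
  · rw [integral_const_mul]
    simp_rw [sq]
  · intro j _ hj
    rw [integral_const_mul, h i j hj.symm, mul_zero]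

/-- Independent centred errors with fourth moments and inverse variances bounded by `C`. -/
structure ErrorBounds {n : ℕ} (μ : Measure Ω) (e : Fin n → Ω → ℝ) (C : ℝ) : Prop where
  measurable : ∀ i, Measurable (e i)
  indep : iIndepFun e μ
  mean : ∀ i, ∫ ω, e i ω ∂μ = 0
  integrable : ∀ i, Integrable (fun ω => e i ω ^ 4) μ
  var_pos : ∀ i, 0 < ∫ ω, e i ω ^ 2 ∂μ
  bound : ∀ i, ∫ ω, e i ω ^ 4 ∂μ + (∫ ω, e i ω ^ 2 ∂μ)⁻¹ ≤ C

namespace ErrorBounds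

variable {n : ℕ} {e : Fin n → Ω → ℝ} {C : ℝ}

lemma fourth_le (h : ErrorBounds μ e C) (i : Fin n) : ∫ ω, e i ω ^ 4 ∂μ ≤ C := by
  have := inv_pos.2 (h.var_pos i)
  linarith [h.bound i]

lemma pos (h : ErrorBounds μ e C) (i : Fin n) : 0 < C := by
  have h1 := inv_pos.2 (h.var_pos i)
  have h2 : 0 ≤ ∫ ω, e i ω ^ 4 ∂μ := integral_nonneg fun ω => by positivity
  linarith [h.bound i]

lemma inv_le_var (h : ErrorBounds μ e C) (i : Fin n) : C⁻¹ ≤ ∫ ω, e i ω ^ 2 ∂μ := by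
  have h2 : 0 ≤ ∫ ω, e i ω ^ 4 ∂μ := integral_nonneg fun ω => by positivity
  exact inv_le_of_inv_le₀ (h.var_pos i) (by linarith [h.bound i])

lemma integrable_mul_four (h : ErrorBounds μ e C) (i j k l : Fin n) :
    Integrable (fun ω => e i ω * e j ω * (e k ω * e l ω)) μ := by
  have hm := h.measurable
  refine Integrable.mono' (((h.integrable i).add (h.integrable j)).add
    ((h.integrable k).add (h.integrable l)))
    (((hm i).mul (hm j)).mul ((hm k).mul (hm l))).aestronglyMeasurable (ae_of_all _ fun ω => ?_)
  simp only [Real.norm_eq_abs, Pi.add_apply]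
  generalize e i ω = a
  generalize e j ω = b
  generalize e k ω = c
  generalize e l ω = d
  rw [abs_le]
  -- Arithmetic–geometric means: |abcd| ≤ a⁴ + b⁴ + c⁴ + d⁴.
  constructor <;> nlinarith [sq_nonneg (a * b + c * d), sq_nonneg (a * b - c * d),
    sq_nonneg (a ^ 2 - b ^ 2), sq_nonneg (c ^ 2 - d ^ 2), sq_nonneg (a ^ 2), sq_nonneg (b ^ 2),
    sq_nonneg (c ^ 2), sq_nonneg (d ^ 2)]

/-- By independence the expectation factors, and an error occurring to the first power contributes
its zero mean. Mixed moments below vanish by writing their exponents as sums of indicators. -/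
lemma integral_monomial_eq_zero (h : ErrorBounds μ e C) {p : Fin n → ℕ} {i : Fin n}
    (hp : p i = 1) : ∫ ω, ∏ m, e m ω ^ p m ∂μ = 0 := by
  rw [h.indep.integral_fun_prod_comp (f := fun m t => t ^ p m)
    (fun m => (h.measurable m).aemeasurable)
    (fun m => (measurable_id.pow_const _).aestronglyMeasurable)]
  refine Finset.prod_eq_zero (Finset.mem_univ i) ?_
  simp only [hp, pow_one]
  exact h.mean i

lemma integral_mul_eq_zero (h : ErrorBounds μ e C) {i j : Fin n} (hij : i ≠ j) :
    ∫ ω, e i ω * e j ω ∂μ = 0 := by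
  have := h.integral_monomial_eq_zero
    (p := fun m => (if m = i then 1 else 0) + (if m = j then 1 else 0)) (i := i) (by simp [hij])
  simpa only [pow_add, Finset.prod_mul_distrib, prod_pow_indicator] using this

lemma integral_mul_mul_eq_zero (h : ErrorBounds μ e C) {i j k : Fin n} (hij : i ≠ j)
    (hik : i ≠ k) : ∫ ω, e i ω * (e j ω * e k ω) ∂μ = 0 := by
  have := h.integral_monomial_eq_zero
    (p := fun m => (if m = i then 1 else 0) + ((if m = j then 1 else 0) +
      (if m = k then 1 else 0))) (i := i) (by simp [hij, hik])
  simpa only [pow_add, Finset.prod_mul_distrib, prod_pow_indicator] using this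

lemma integral_mul_four_eq_zero (h : ErrorBounds μ e C) {i j k l : Fin n} (hij : i ≠ j)
    (hik : i ≠ k) (hil : i ≠ l) : ∫ ω, e i ω * e j ω * (e k ω * e l ω) ∂μ = 0 := by
  have := h.integral_monomial_eq_zero
    (p := fun m => (if m = i then 1 else 0) + (if m = j then 1 else 0) +
      ((if m = k then 1 else 0) + (if m = l then 1 else 0))) (i := i) (by simp [hij, hik, hil])
  simpa only [pow_add, Finset.prod_mul_distrib, prod_pow_indicator] using this

lemma integral_sq_mul_sq (h : ErrorBounds μ e C) {i j : Fin n} (hij : i ≠ j) :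
    ∫ ω, e i ω ^ 2 * e j ω ^ 2 ∂μ = (∫ ω, e i ω ^ 2 ∂μ) * ∫ ω, e j ω ^ 2 ∂μ :=
  (h.indep.indepFun hij).integral_fun_comp_mul_comp (f := fun t => t ^ 2) (g := fun t => t ^ 2)
    (h.measurable i).aemeasurable (h.measurable j).aemeasurable
    (measurable_id.pow_const _).aestronglyMeasurable
    (measurable_id.pow_const _).aestronglyMeasurable

/-- Unless the pairs {i, j} and {k, l} coincide, some index occurs exactly once and the moment
vanishes. -/
lemma integral_mul_four (h : ErrorBounds μ e C) {i j k l : Fin n} (hij : i ≠ j) (hkl : k ≠ l) :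
    ∫ ω, e i ω * e j ω * (e k ω * e l ω) ∂μ =
      (if k = i ∧ l = j then (∫ ω, e i ω ^ 2 ∂μ) * ∫ ω, e j ω ^ 2 ∂μ else 0) +
      (if k = j ∧ l = i then (∫ ω, e i ω ^ 2 ∂μ) * ∫ ω, e j ω ^ 2 ∂μ else 0) := by
  have hsq : ∫ ω, e i ω * e j ω * (e i ω * e j ω) ∂μ =
      (∫ ω, e i ω ^ 2 ∂μ) * ∫ ω, e j ω ^ 2 ∂μ := by
    rw [← h.integral_sq_mul_sq hij]
    exact integral_congr_ae (ae_of_all _ fun ω => by ring)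
  by_cases hik : i = k
  · subst hik
    by_cases hjl : j = l
    · subst hjl
      simp [hij, hsq]
    · have : ∫ ω, e i ω * e j ω * (e i ω * e l ω) ∂μ = 0 := by
        rw [← h.integral_mul_four_eq_zero hij.symm hij.symm hjl]
        exact integral_congr_ae (ae_of_all _ fun ω => by ring)
      rw [this]
      simp [hij, Ne.symm hjl]
  · by_cases hil : i = l
    · subst hil
      by_cases hjk : j = k
      · subst hjk
        have : ∫ ω, e i ω * e j ω * (e j ω * e i ω) ∂μ =
            ∫ ω, e i ω * e j ω * (e i ω * e j ω) ∂μ :=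
          integral_congr_ae (ae_of_all _ fun ω => by ring)
        simp [hij, hij.symm, this, hsq]
      · have : ∫ ω, e i ω * e j ω * (e k ω * e i ω) ∂μ = 0 := by
          rw [← h.integral_mul_four_eq_zero hij.symm hjk hij.symm]
          exact integral_congr_ae (ae_of_all _ fun ω => by ring)
        rw [this]
        simp [Ne.symm hik, Ne.symm hjk]
    · rw [h.integral_mul_four_eq_zero hij hik hil]
      simp [Ne.symm hik, Ne.symm hil]

lemma memLp_two_mul (h : ErrorBounds μ e C) (i j : Fin n) :
    MemLp (fun ω => e i ω * e j ω) 2 μ := by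
  refine (memLp_two_iff_integrable_sq
    ((h.measurable i).mul (h.measurable j)).aestronglyMeasurable).2 ?_
  simpa only [sq, Pi.mul_apply] using h.integrable_mul_four i j i j

lemma integral_quadratic_sq (h : ErrorBounds μ e C) {c : Fin n → Fin n → ℝ}
    (hc : ∀ i, c i i = 0) :
    ∫ ω, (∑ i, ∑ j, c i j * (e i ω * e j ω)) ^ 2 ∂μ =
      ∑ i, ∑ j, (c i j ^ 2 + c i j * c j i) *
        ((∫ ω, e i ω ^ 2 ∂μ) * ∫ ω, e j ω ^ 2 ∂μ) := by
  have hint : ∀ i j k l, Integrable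
      (fun ω => c i j * c k l * (e i ω * e j ω * (e k ω * e l ω))) μ := fun i j k l =>
    (h.integrable_mul_four i j k l).const_mul _
  have e1 : ∀ ω, (∑ i, ∑ j, c i j * (e i ω * e j ω)) ^ 2 =
      ∑ i, ∑ j, ∑ k, ∑ l, c i j * c k l * (e i ω * e j ω * (e k ω * e l ω)) := fun ω => by
    simp_rw [sq, Finset.sum_mul, Finset.mul_sum]
    exact Finset.sum_congr rfl fun i _ => Finset.sum_congr rfl fun j _ =>
      Finset.sum_congr rfl fun k _ => Finset.sum_congr rfl fun l _ => by ring
  simp_rw [e1]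
  rw [integral_finsetSum _ fun i _ => integrable_finsetSum _ fun j _ =>
    integrable_finsetSum _ fun k _ => integrable_finsetSum _ fun l _ => hint i j k l]
  refine Finset.sum_congr rfl fun i _ => ?_
  rw [integral_finsetSum _ fun j _ =>
    integrable_finsetSum _ fun k _ => integrable_finsetSum _ fun l _ => hint i j k l]
  refine Finset.sum_congr rfl fun j _ => ?_
  rw [integral_finsetSum _ fun k _ => integrable_finsetSum _ fun l _ => hint i j k l]
  have e2 : ∀ k l, ∫ ω, c i j * c k l * (e i ω * e j ω * (e k ω * e l ω)) ∂μ =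
      (if k = i then if l = j then
        c i j * c i j * ((∫ ω, e i ω ^ 2 ∂μ) * ∫ ω, e j ω ^ 2 ∂μ) else 0 else 0) +
      (if k = j then if l = i then
        c i j * c j i * ((∫ ω, e i ω ^ 2 ∂μ) * ∫ ω, e j ω ^ 2 ∂μ) else 0 else 0) := by
    intro k l
    rw [integral_const_mul]
    by_cases hij : i = j
    · subst hij; simp [hc]
    by_cases hkl : k = l
    · subst hkl
      rw [hc, mul_zero, zero_mul]
      split_ifs with h1 h2 h3 <;> simp_all
    rw [h.integral_mul_four hij hkl, ite_and, ite_and]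
    split_ifs <;> simp_all
  simp_rw [fun k => integral_finsetSum (μ := μ) Finset.univ
    (fun l _ => hint i j k l), e2, Finset.sum_add_distrib]
  simp
  ring

lemma memLp_quadratic (h : ErrorBounds μ e C) (c : Fin n → Fin n → ℝ) :
    MemLp (fun ω => ∑ i, ∑ j, c i j * (e i ω * e j ω)) 2 μ :=
  memLp_finsetSum _ fun i _ => memLp_finsetSum _ fun j _ => (h.memLp_two_mul i j).const_mul _

variable [IsProbabilityMeasure μ]

lemma memLp_two (h : ErrorBounds μ e C) (i : Fin n) : MemLp (e i) 2 μ := by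
  rw [memLp_two_iff_integrable_sq (h.measurable i).aestronglyMeasurable]
  refine Integrable.mono' ((integrable_const (1 : ℝ)).add (h.integrable i))
    ((h.measurable i).pow_const 2).aestronglyMeasurable (ae_of_all _ fun ω => ?_)
  simp only [Real.norm_eq_abs, abs_pow, sq_abs, Pi.add_apply]
  nlinarith [sq_nonneg (e i ω ^ 2 - 1), sq_nonneg (e i ω ^ 2)]

lemma var_le (h : ErrorBounds μ e C) (i : Fin n) : ∫ ω, e i ω ^ 2 ∂μ ≤ 1 + C := by
  calc ∫ ω, e i ω ^ 2 ∂μ ≤ ∫ ω, (1 + e i ω ^ 4) ∂μ := by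
        refine integral_mono (h.memLp_two i).integrable_sq
          ((integrable_const (1 : ℝ)).add (h.integrable i)) fun ω => ?_
        show e i ω ^ 2 ≤ 1 + e i ω ^ 4
        nlinarith [sq_nonneg (e i ω ^ 2 - 1), sq_nonneg (e i ω ^ 2)]
    _ = 1 + ∫ ω, e i ω ^ 4 ∂μ := by
        rw [integral_add (integrable_const _) (h.integrable i)]
        simp
    _ ≤ 1 + C := by linarith [h.fourth_le i]

lemma memLp_linear (h : ErrorBounds μ e C) (a : Fin n → ℝ) :
    MemLp (fun ω => ∑ i, a i * e i ω) 2 μ :=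
  memLp_finsetSum _ fun i _ => (h.memLp_two i).const_mul _

lemma integral_linear (h : ErrorBounds μ e C) (a : Fin n → ℝ) :
    ∫ ω, ∑ i, a i * e i ω ∂μ = 0 := by
  rw [integral_finsetSum _ fun i _ => ((h.memLp_two i).integrable one_le_two).const_mul _]
  simp [integral_const_mul, h.mean]

lemma integral_linear_mul_linear (h : ErrorBounds μ e C) (a b : Fin n → ℝ) :
    ∫ ω, (∑ i, a i * e i ω) * (∑ j, b j * e j ω) ∂μ = ∑ i, a i * b i * ∫ ω, e i ω ^ 2 ∂μ :=
  integral_sum_mul_sum h.memLp_two (fun _ _ hij => h.integral_mul_eq_zero hij) a b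

lemma integral_quadratic (h : ErrorBounds μ e C) {c : Fin n → Fin n → ℝ}
    (hc : ∀ i, c i i = 0) : ∫ ω, ∑ i, ∑ j, c i j * (e i ω * e j ω) ∂μ = 0 := by
  have hint : ∀ i j, Integrable (fun ω => c i j * (e i ω * e j ω)) μ := fun i j =>
    ((h.memLp_two_mul i j).integrable one_le_two).const_mul _
  rw [integral_finsetSum _ fun i _ => integrable_finsetSum _ fun j _ => hint i j]
  refine Finset.sum_eq_zero fun i _ => ?_
  rw [integral_finsetSum _ fun j _ => hint i j]
  refine Finset.sum_eq_zero fun j _ => ?_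
  rw [integral_const_mul]
  by_cases hij : i = j
  · rw [hij, hc, zero_mul]
  · rw [h.integral_mul_eq_zero hij, mul_zero]

/-- For i ≠ j, at least one index in εₖεᵢεⱼ occurs exactly once. So, without any assumption on third
moments, linear forms are uncorrelated with zero-diagonal quadratic forms. -/
lemma integral_mul_quadratic (h : ErrorBounds μ e C) {c : Fin n → Fin n → ℝ}
    (hc : ∀ i, c i i = 0) (k : Fin n) :
    ∫ ω, e k ω * ∑ i, ∑ j, c i j * (e i ω * e j ω) ∂μ = 0 := by
  have hint : ∀ i j, Integrable (fun ω => c i j * (e k ω * (e i ω * e j ω))) μ := fun i j =>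
    ((h.memLp_two k).integrable_mul (h.memLp_two_mul i j)).const_mul _
  have e1 : ∀ ω, e k ω * ∑ i, ∑ j, c i j * (e i ω * e j ω) =
      ∑ i, ∑ j, c i j * (e k ω * (e i ω * e j ω)) := fun ω => by
    simp_rw [Finset.mul_sum]
    exact Finset.sum_congr rfl fun i _ => Finset.sum_congr rfl fun j _ => by ring
  simp_rw [e1]
  rw [integral_finsetSum _ fun i _ => integrable_finsetSum _ fun j _ => hint i j]
  refine Finset.sum_eq_zero fun i _ => ?_
  rw [integral_finsetSum _ fun j _ => hint i j]
  refine Finset.sum_eq_zero fun j _ => ?_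
  rw [integral_const_mul]
  by_cases hij : i = j
  · rw [hij, hc, zero_mul]
  rw [mul_eq_zero]
  right
  by_cases hki : k = i
  · subst hki
    rw [← h.integral_mul_mul_eq_zero (Ne.symm hij) (Ne.symm hij)]
    exact integral_congr_ae (ae_of_all _ fun ω => by ring)
  by_cases hkj : k = j
  · subst hkj
    rw [← h.integral_mul_mul_eq_zero hij hij]
    exact integral_congr_ae (ae_of_all _ fun ω => by ring)
  exact h.integral_mul_mul_eq_zero hki hkj

lemma integral_linear_mul_quadratic (h : ErrorBounds μ e C) (a : Fin n → ℝ)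
    {c : Fin n → Fin n → ℝ} (hc : ∀ i, c i i = 0) :
    ∫ ω, (∑ k, a k * e k ω) * ∑ i, ∑ j, c i j * (e i ω * e j ω) ∂μ = 0 := by
  simp_rw [Finset.sum_mul, mul_assoc]
  have hint : ∀ k, Integrable
      (fun ω => a k * (e k ω * ∑ i, ∑ j, c i j * (e i ω * e j ω))) μ := fun k =>
    ((h.memLp_two k).integrable_mul (h.memLp_quadratic c)).const_mul _
  rw [integral_finsetSum _ fun k _ => hint k]
  refine Finset.sum_eq_zero fun k _ => ?_
  rw [integral_const_mul, h.integral_mul_quadratic hc, mul_zero]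

end ErrorBounds

end Moments

/-! ### Variance bounds for quadratic forms and for sums of leave-out estimates -/

section Moments

variable {Ω : Type*} [MeasurableSpace Ω] {μ : Measure Ω}

namespace ErrorBounds

variable {n : ℕ} {e : Fin n → Ω → ℝ} {C : ℝ}

/-- The weight σᵢ²σⱼ² is symmetric, so the coefficients may be symmetrized. Each term is then
nonnegative, and the variances can be replaced by upper or lower bounds. -/
lemma integral_quadratic_sq_eq (h : ErrorBounds μ e C) {c : Fin n → Fin n → ℝ}
    (hc : ∀ i, c i i = 0) :
    ∫ ω, (∑ i, ∑ j, c i j * (e i ω * e j ω)) ^ 2 ∂μ =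
      ∑ i, ∑ j, (c i j + c j i) ^ 2 / 2 *
        ((∫ ω, e i ω ^ 2 ∂μ) * ∫ ω, e j ω ^ 2 ∂μ) := by
  rw [h.integral_quadratic_sq hc]
  set s : Fin n → ℝ := fun i => ∫ ω, e i ω ^ 2 ∂μ
  have h1 : ∑ i, ∑ j, c i j ^ 2 / 2 * (s i * s j) = ∑ i, ∑ j, c j i ^ 2 / 2 * (s i * s j) := by
    rw [Finset.sum_comm]
    exact Finset.sum_congr rfl fun i _ => Finset.sum_congr rfl fun j _ => by ring
  have h2 : ∑ i, ∑ j, (c i j ^ 2 + c i j * c j i) * (s i * s j) =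
      ∑ i, ∑ j, (c i j + c j i) ^ 2 / 2 * (s i * s j) +
      (∑ i, ∑ j, c i j ^ 2 / 2 * (s i * s j) - ∑ i, ∑ j, c j i ^ 2 / 2 * (s i * s j)) := by
    simp_rw [← Finset.sum_sub_distrib, ← Finset.sum_add_distrib]
    exact Finset.sum_congr rfl fun i _ => Finset.sum_congr rfl fun j _ => by ring
  rw [h2, h1, sub_self, add_zero]

variable [IsProbabilityMeasure μ]

lemma integral_linear_sq_le (h : ErrorBounds μ e C) (a : Fin n → ℝ) :
    ∫ ω, (∑ i, a i * e i ω) ^ 2 ∂μ ≤ (1 + C) * ∑ i, a i ^ 2 := by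
  simp_rw [sq (∑ i, _)]
  rw [h.integral_linear_mul_linear, Finset.mul_sum]
  refine Finset.sum_le_sum fun i _ => ?_
  rw [← sq, mul_comm]
  gcongr
  exact h.var_le i

lemma integral_quadratic_sq_le (h : ErrorBounds μ e C) {c : Fin n → Fin n → ℝ}
    (hc : ∀ i, c i i = 0) :
    ∫ ω, (∑ i, ∑ j, c i j * (e i ω * e j ω)) ^ 2 ∂μ ≤
      2 * (1 + C) ^ 2 * ∑ i, ∑ j, c i j ^ 2 := by
  rw [h.integral_quadratic_sq_eq hc]
  have hs : ∀ i, ∫ ω, e i ω ^ 2 ∂μ ≤ 1 + C := h.var_le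
  have hp : ∀ i, 0 < ∫ ω, e i ω ^ 2 ∂μ := h.var_pos
  have h0 : ∀ i j, (c i j + c j i) ^ 2 / 2 * ((∫ ω, e i ω ^ 2 ∂μ) * ∫ ω, e j ω ^ 2 ∂μ) ≤
      (c i j ^ 2 + c j i ^ 2) * (1 + C) ^ 2 := by
    intro i j
    have := (hp i).le.trans (hs i)
    have h1 : (∫ ω, e i ω ^ 2 ∂μ) * ∫ ω, e j ω ^ 2 ∂μ ≤ (1 + C) ^ 2 := by
      rw [sq]
      exact mul_le_mul (hs i) (hs j) (hp j).le this
    have h2 : (c i j + c j i) ^ 2 / 2 ≤ c i j ^ 2 + c j i ^ 2 := by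
      nlinarith [sq_nonneg (c i j - c j i)]
    exact mul_le_mul h2 h1 (mul_pos (hp i) (hp j)).le (by positivity)
  calc _ ≤ ∑ i, ∑ j, (c i j ^ 2 + c j i ^ 2) * (1 + C) ^ 2 :=
        Finset.sum_le_sum fun i _ => Finset.sum_le_sum fun j _ => h0 i j
    _ = (∑ i, ∑ j, c i j ^ 2 + ∑ i, ∑ j, c j i ^ 2) * (1 + C) ^ 2 := by
        simp_rw [← Finset.sum_add_distrib, Finset.sum_mul]
    _ = _ := by
        rw [Finset.sum_comm (f := fun i j => c j i ^ 2)]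
        ring

lemma le_integral_quadratic_sq (h : ErrorBounds μ e C) {B c : Fin n → Fin n → ℝ}
    (hB : ∀ i j, B i j = B j i) (hc : ∀ i, c i i = 0) :
    (C⁻¹) ^ 2 * (∑ i, ∑ j, B i j ^ 2 - ∑ i, B i i ^ 2) - 2 * (1 + C) ^ 2 * ∑ i, ∑ j, c i j ^ 2 ≤
    ∫ ω, (∑ i, ∑ j, ((if i = j then 0 else B i j) + c i j) * (e i ω * e j ω)) ^ 2 ∂μ := by
  set B' : Fin n → Fin n → ℝ := fun i j => if i = j then 0 else B i j with hB'
  have hB's : ∀ i j, B' i j = B' j i := fun i j => by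
    simp only [hB', eq_comm (a := i) (b := j), hB i j]
  have hsum : ∑ i, ∑ j, B i j ^ 2 - ∑ i, B i i ^ 2 = ∑ i, ∑ j, B' i j ^ 2 := by
    rw [← Finset.sum_sub_distrib]
    refine Finset.sum_congr rfl fun i _ => ?_
    rw [← Finset.add_sum_erase _ _ (Finset.mem_univ i), add_sub_cancel_left,
      ← Finset.add_sum_erase Finset.univ (fun j => B' i j ^ 2) (Finset.mem_univ i)]
    simp only [hB', if_true]
    rw [zero_pow two_ne_zero, zero_add]
    refine Finset.sum_congr rfl fun j hj => ?_
    rw [if_neg (Finset.ne_of_mem_erase hj).symm]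
  rw [hsum, h.integral_quadratic_sq_eq (c := fun i j => B' i j + c i j)
    fun i => by simp [hB', hc]]
  have hs : ∀ i, ∫ ω, e i ω ^ 2 ∂μ ≤ 1 + C := h.var_le
  have hp : ∀ i, 0 < ∫ ω, e i ω ^ 2 ∂μ := h.var_pos
  have h0 : ∀ i j, (C⁻¹) ^ 2 * B' i j ^ 2 - (c i j ^ 2 + c j i ^ 2) * (1 + C) ^ 2 ≤
      (B' i j + c i j + (B' j i + c j i)) ^ 2 / 2 *
        ((∫ ω, e i ω ^ 2 ∂μ) * ∫ ω, e j ω ^ 2 ∂μ) := by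
    intro i j
    have := (hp i).le.trans (hs i)
    have hC := inv_pos.2 (h.pos i)
    have h1 : (∫ ω, e i ω ^ 2 ∂μ) * ∫ ω, e j ω ^ 2 ∂μ ≤ (1 + C) ^ 2 := by
      rw [sq]
      exact mul_le_mul (hs i) (hs j) (hp j).le this
    have h2 : (C⁻¹) ^ 2 ≤ (∫ ω, e i ω ^ 2 ∂μ) * ∫ ω, e j ω ^ 2 ∂μ := by
      rw [sq]
      exact mul_le_mul (h.inv_le_var i) (h.inv_le_var j) hC.le (hp i).le
    set s := (∫ ω, e i ω ^ 2 ∂μ) * ∫ ω, e j ω ^ 2 ∂μ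
    have h3 : 0 < s := mul_pos (hp i) (hp j)
    rw [hB's j i]
    -- With t = cᵢⱼ + cⱼᵢ, (2B' + t)²/2 - B'² = (B' + t)² - t²/2, and t²/2 ≤ cᵢⱼ² + cⱼᵢ².
    have h4 : B' i j ^ 2 - (c i j ^ 2 + c j i ^ 2) ≤
        (B' i j + c i j + (B' i j + c j i)) ^ 2 / 2 := by
      nlinarith [sq_nonneg (B' i j + (c i j + c j i)), sq_nonneg (c i j - c j i)]
    calc _ ≤ s * B' i j ^ 2 - (c i j ^ 2 + c j i ^ 2) * s := by gcongr
      _ = (B' i j ^ 2 - (c i j ^ 2 + c j i ^ 2)) * s := by ring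
      _ ≤ _ := mul_le_mul_of_nonneg_right h4 h3.le
  calc _ = ∑ i, ∑ j, ((C⁻¹) ^ 2 * B' i j ^ 2 - (c i j ^ 2 + c j i ^ 2) * (1 + C) ^ 2) := by
        simp_rw [Finset.sum_sub_distrib, ← Finset.sum_mul, ← Finset.mul_sum,
          Finset.sum_add_distrib]
        rw [Finset.sum_comm (f := fun i j => c j i ^ 2)]
        ring
    _ ≤ _ := Finset.sum_le_sum fun i _ => Finset.sum_le_sum fun j _ => h0 i j

lemma memLp_sq_sub (h : ErrorBounds μ e C) (i : Fin n) :
    MemLp (fun ω => e i ω ^ 2 - ∫ ω', e i ω' ^ 2 ∂μ) 2 μ := by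
  have := h.memLp_two_mul i i
  simp only [← sq] at this
  exact this.sub (memLp_const _)

lemma integral_sum_sq_sub_sq_le (h : ErrorBounds μ e C) (g : Fin n → ℝ) :
    ∫ ω, (∑ i, g i * (e i ω ^ 2 - ∫ ω', e i ω' ^ 2 ∂μ)) ^ 2 ∂μ ≤ C * ∑ i, g i ^ 2 := by
  have hint : ∀ i, Integrable (fun ω => e i ω ^ 2) μ := fun i => (h.memLp_two i).integrable_sq
  have hmean : ∀ i, ∫ ω, (e i ω ^ 2 - ∫ ω', e i ω' ^ 2 ∂μ) ∂μ = 0 := fun i => by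
    rw [integral_sub (hint i) (integrable_const _)]
    simp
  have hunc : ∀ i j, i ≠ j → ∫ ω, (e i ω ^ 2 - ∫ ω', e i ω' ^ 2 ∂μ) *
      (e j ω ^ 2 - ∫ ω', e j ω' ^ 2 ∂μ) ∂μ = 0 := fun i j hij => by
    rw [(h.indep.indepFun hij).integral_fun_comp_mul_comp
      (f := fun t => t ^ 2 - ∫ ω', e i ω' ^ 2 ∂μ) (g := fun t => t ^ 2 - ∫ ω', e j ω' ^ 2 ∂μ)
      (h.measurable i).aemeasurable (h.measurable j).aemeasurable
      ((measurable_id.pow_const _).sub_const _).aestronglyMeasurable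
      ((measurable_id.pow_const _).sub_const _).aestronglyMeasurable, hmean, zero_mul]
  simp_rw [sq (∑ i, _)]
  rw [integral_sum_mul_sum h.memLp_sq_sub hunc, Finset.mul_sum]
  refine Finset.sum_le_sum fun i _ => ?_
  rw [← sq, mul_comm]
  gcongr
  have hv := h.var_pos i
  calc ∫ ω, (e i ω ^ 2 - ∫ ω', e i ω' ^ 2 ∂μ) ^ 2 ∂μ
      = ∫ ω, (e i ω ^ 4 - (2 * (∫ ω', e i ω' ^ 2 ∂μ) * e i ω ^ 2 -
          (∫ ω', e i ω' ^ 2 ∂μ) ^ 2)) ∂μ :=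
        integral_congr_ae (ae_of_all _ fun ω => by ring)
    _ = ∫ ω, e i ω ^ 4 ∂μ - (∫ ω', e i ω' ^ 2 ∂μ) ^ 2 := by
        have h1 : Integrable (fun ω => 2 * (∫ ω', e i ω' ^ 2 ∂μ) * e i ω ^ 2 -
          (∫ ω', e i ω' ^ 2 ∂μ) ^ 2) μ := ((hint i).const_mul _).sub (integrable_const _)
        rw [integral_sub (h.integrable i) h1, integral_sub ((hint i).const_mul _) (integrable_const _), integral_const_mul]
        simp
        ring
    _ ≤ C := by nlinarith [h.fourth_le i]

/-- The second moment of `∑ᵢ gᵢ (σ̂ᵢ² - σᵢ²)`, where `σ̂ᵢ² = (mᵢ + εᵢ) (εᵢ - ∑ⱼ Kᵢⱼ εⱼ)`. -/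
lemma integral_sum_estimate_sub_sq_le (h : ErrorBounds μ e C) {m : Fin n → ℝ}
    {K : Fin n → Fin n → ℝ} {κ D : ℝ} (hK : ∀ i, K i i = 0) (hrow : ∀ i, ∑ j, K i j ^ 2 ≤ κ)
    (hcol : ∀ g : Fin n → ℝ, ∑ j, (∑ i, g i * K i j) ^ 2 ≤ 4 * κ * ∑ i, g i ^ 2)
    (hm : ∀ i, m i ^ 2 ≤ D) (g : Fin n → ℝ) :
    MemLp (fun ω => ∑ i, g i * ((m i + e i ω) * (e i ω - ∑ j, K i j * e j ω) -
      ∫ ω', e i ω' ^ 2 ∂μ)) 2 μ ∧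
    ∫ ω, (∑ i, g i * ((m i + e i ω) * (e i ω - ∑ j, K i j * e j ω) -
      ∫ ω', e i ω' ^ 2 ∂μ)) ^ 2 ∂μ ≤
      3 * (C + (1 + C) * (2 * D + 8 * κ * D) + 2 * (1 + C) ^ 2 * κ) * ∑ i, g i ^ 2 := by
  -- The product in σ̂ᵢ² splits the sum as X + Y - Z: centred squares, a linear form carrying the
  -- signal, and a quadratic form with the zero diagonal of K.
  set X : Ω → ℝ := fun ω => ∑ i, g i * (e i ω ^ 2 - ∫ ω', e i ω' ^ 2 ∂μ) with hX
  set a : Fin n → ℝ := fun j => g j * m j - ∑ i, g i * m i * K i j with ha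
  set Y : Ω → ℝ := fun ω => ∑ j, a j * e j ω with hY
  set c : Fin n → Fin n → ℝ := fun i j => g i * K i j with hc
  set Z : Ω → ℝ := fun ω => ∑ i, ∑ j, c i j * (e i ω * e j ω) with hZ
  have hc0 : ∀ i, c i i = 0 := fun i => by simp [hc, hK]
  have hXm : MemLp X 2 μ := memLp_finsetSum _ fun i _ => (h.memLp_sq_sub i).const_mul _
  have hYm : MemLp Y 2 μ := h.memLp_linear _
  have hZm : MemLp Z 2 μ := h.memLp_quadratic _
  have hdec : (fun ω => ∑ i, g i * ((m i + e i ω) * (e i ω - ∑ j, K i j * e j ω) -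
      ∫ ω', e i ω' ^ 2 ∂μ)) = fun ω => X ω + Y ω - Z ω := by
    funext ω
    have h1 : Y ω = ∑ i, g i * m i * e i ω - ∑ i, g i * m i * ∑ j, K i j * e j ω := by
      simp only [hY, ha, sub_mul, Finset.sum_sub_distrib, Finset.sum_mul, Finset.mul_sum]
      rw [Finset.sum_comm (f := fun j i => g i * m i * K i j * e j ω)]
      simp only [mul_assoc]
    have h2 : Z ω = ∑ i, g i * e i ω * ∑ j, K i j * e j ω := by
      simp only [hZ, hc, Finset.mul_sum]
      exact Finset.sum_congr rfl fun i _ => Finset.sum_congr rfl fun j _ => by ring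
    rw [h1, h2]
    simp only [hX]
    rw [← Finset.sum_sub_distrib, ← Finset.sum_add_distrib, ← Finset.sum_sub_distrib]
    exact Finset.sum_congr rfl fun i _ => by ring
  rw [hdec]
  refine ⟨(hXm.add hYm).sub hZm, ?_⟩
  have hdec' : ∀ ω, (∑ i, g i * ((m i + e i ω) * (e i ω - ∑ j, K i j * e j ω) -
      ∫ ω', e i ω' ^ 2 ∂μ)) = X ω + Y ω - Z ω := congrFun hdec
  simp_rw [hdec']
  have hG : 0 ≤ ∑ i, g i ^ 2 := by positivity
  have bX : ∫ ω, X ω ^ 2 ∂μ ≤ C * ∑ i, g i ^ 2 := h.integral_sum_sq_sub_sq_le g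
  have bgm : ∑ i, (g i * m i) ^ 2 ≤ D * ∑ i, g i ^ 2 := by
    rw [Finset.mul_sum]
    refine Finset.sum_le_sum fun i _ => ?_
    rw [mul_pow, mul_comm]
    exact mul_le_mul_of_nonneg_right (hm i) (sq_nonneg _)
  -- The signs of C and κ are read off from an index, so the empty sample is treated apart.
  rcases isEmpty_or_nonempty (Fin n) with hn | ⟨⟨i₀⟩⟩
  · simp [hX, hY, hZ]
  have hC : 0 < C := h.pos i₀
  have hκ : 0 ≤ κ := le_trans (by positivity) (hrow i₀)
  have ba : ∑ j, a j ^ 2 ≤ (2 * D + 8 * κ * D) * ∑ i, g i ^ 2 := by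
    calc ∑ j, a j ^ 2 ≤ ∑ j, (2 * (g j * m j) ^ 2 + 2 * (∑ i, g i * m i * K i j) ^ 2) := by
          refine Finset.sum_le_sum fun j _ => ?_
          simp only [ha]
          nlinarith [sq_nonneg (g j * m j + ∑ i, g i * m i * K i j)]
      _ = 2 * ∑ j, (g j * m j) ^ 2 + 2 * ∑ j, (∑ i, g i * m i * K i j) ^ 2 := by
          rw [Finset.sum_add_distrib, Finset.mul_sum, Finset.mul_sum]
      _ ≤ 2 * (D * ∑ i, g i ^ 2) + 2 * (4 * κ * (D * ∑ i, g i ^ 2)) := by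
          gcongr
          exact (hcol fun i => g i * m i).trans (by gcongr)
      _ = _ := by ring
  have bY : ∫ ω, Y ω ^ 2 ∂μ ≤ (1 + C) * ((2 * D + 8 * κ * D) * ∑ i, g i ^ 2) :=
    (h.integral_linear_sq_le a).trans (by gcongr)
  have bZ : ∫ ω, Z ω ^ 2 ∂μ ≤ 2 * (1 + C) ^ 2 * (κ * ∑ i, g i ^ 2) := by
    refine (h.integral_quadratic_sq_le hc0).trans ?_
    gcongr
    rw [Finset.mul_sum]
    refine Finset.sum_le_sum fun i _ => ?_
    simp only [hc, mul_pow, ← Finset.mul_sum]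
    rw [mul_comm]
    exact mul_le_mul_of_nonneg_right (hrow i) (sq_nonneg _)
  calc ∫ ω, (X ω + Y ω - Z ω) ^ 2 ∂μ
      ≤ ∫ ω, (3 * X ω ^ 2 + 3 * Y ω ^ 2 + 3 * Z ω ^ 2) ∂μ := by
        refine integral_mono ((hXm.add hYm).sub hZm).integrable_sq
          (((hXm.integrable_sq.const_mul 3).add (hYm.integrable_sq.const_mul 3)).add
            (hZm.integrable_sq.const_mul 3)) fun ω => ?_
        show (X ω + Y ω - Z ω) ^ 2 ≤ 3 * X ω ^ 2 + 3 * Y ω ^ 2 + 3 * Z ω ^ 2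
        nlinarith [sq_nonneg (X ω - Y ω), sq_nonneg (X ω + Z ω), sq_nonneg (Y ω + Z ω)]
    _ = 3 * ∫ ω, X ω ^ 2 ∂μ + 3 * ∫ ω, Y ω ^ 2 ∂μ + 3 * ∫ ω, Z ω ^ 2 ∂μ := by
        have iX : Integrable (fun ω => 3 * X ω ^ 2) μ := hXm.integrable_sq.const_mul 3
        have iY : Integrable (fun ω => 3 * Y ω ^ 2) μ := hYm.integrable_sq.const_mul 3
        have iZ : Integrable (fun ω => 3 * Z ω ^ 2) μ := hZm.integrable_sq.const_mul 3
        have iXY : Integrable (fun ω => 3 * X ω ^ 2 + 3 * Y ω ^ 2) μ := iX.add iY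
        rw [integral_add iXY iZ, integral_add iX iY]
        simp only [integral_const_mul]
    _ ≤ _ := by linarith

/-- A lower bound for the variance of the leave-out estimator of a quadratic form. -/
lemma le_variance_quadratic_sub_estimate (h : ErrorBounds μ e C) {m : Fin n → ℝ}
    {K B : Fin n → Fin n → ℝ} {κ : ℝ} (hK : ∀ i, K i i = 0) (hrow : ∀ i, ∑ j, K i j ^ 2 ≤ κ)
    (hB : ∀ i j, B i j = B j i) :
    (C⁻¹) ^ 2 * (∑ i, ∑ j, B i j ^ 2 - ∑ i, B i i ^ 2) -
      2 * (1 + C) ^ 2 * (κ * ∑ i, B i i ^ 2) ≤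
    Var[fun ω => ∑ i, ∑ j, B i j * ((m i + e i ω) * (m j + e j ω)) -
      ∑ i, B i i * ((m i + e i ω) * (e i ω - ∑ j, K i j * e j ω)); μ] := by
  -- The diagonal terms Bᵢᵢεᵢ² cancel against the leave-out correction. What remains is a constant,
  -- a linear form L and a zero-diagonal quadratic form T.
  set c0 : ℝ := ∑ i, ∑ j, B i j * (m i * m j) with hc0
  set a : Fin n → ℝ := fun j => 2 * (∑ i, m i * B i j) - B j j * m j +
    ∑ i, B i i * m i * K i j with ha
  set c : Fin n → Fin n → ℝ := fun i j => B i i * K i j with hc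
  set L : Ω → ℝ := fun ω => ∑ j, a j * e j ω with hL
  set T : Ω → ℝ := fun ω =>
    ∑ i, ∑ j, ((if i = j then 0 else B i j) + c i j) * (e i ω * e j ω) with hT
  have hd0 : ∀ i, (if i = i then 0 else B i i) + c i i = 0 := fun i => by simp [hc, hK]
  have hLm : MemLp L 2 μ := h.memLp_linear _
  have hTm : MemLp T 2 μ := h.memLp_quadratic _
  have hdec : (fun ω => ∑ i, ∑ j, B i j * ((m i + e i ω) * (m j + e j ω)) -
      ∑ i, B i i * ((m i + e i ω) * (e i ω - ∑ j, K i j * e j ω))) =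
      fun ω => c0 + (L ω + T ω) := by
    funext ω
    have h1 : L ω = 2 * ∑ i, ∑ j, m i * B i j * e j ω - ∑ j, B j j * m j * e j ω +
        ∑ i, ∑ j, B i i * m i * K i j * e j ω := by
      simp only [hL, ha, add_mul, sub_mul, Finset.sum_add_distrib, Finset.sum_sub_distrib,
        Finset.sum_mul, mul_assoc, ← Finset.mul_sum]
      rw [Finset.sum_comm (f := fun j i => m i * (B i j * e j ω)),
        Finset.sum_comm (f := fun j i => B i i * (m i * (K i j * e j ω)))]
      simp only [← Finset.mul_sum]
    have h2 : T ω = ∑ i, ∑ j, B i j * (e i ω * e j ω) - ∑ i, B i i * (e i ω * e i ω) +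
        ∑ i, ∑ j, B i i * K i j * (e i ω * e j ω) := by
      have : ∀ i, ∑ j, (if i = j then 0 else B i j) * (e i ω * e j ω) =
          ∑ j, B i j * (e i ω * e j ω) - B i i * (e i ω * e i ω) := by
        intro i
        rw [← Finset.add_sum_erase _ _ (Finset.mem_univ i), if_pos rfl, zero_mul, zero_add,
          ← Finset.add_sum_erase Finset.univ (fun j => B i j * (e i ω * e j ω))
            (Finset.mem_univ i), add_sub_cancel_left]
        refine Finset.sum_congr rfl fun j hj => ?_
        rw [if_neg (Finset.ne_of_mem_erase hj).symm]
      simp only [hT, hc, add_mul, Finset.sum_add_distrib, this, Finset.sum_sub_distrib]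
    have h3 : ∑ i, ∑ j, m j * B i j * e i ω = ∑ i, ∑ j, m i * B i j * e j ω := by
      rw [Finset.sum_comm]
      exact Finset.sum_congr rfl fun i _ => Finset.sum_congr rfl fun j _ => by rw [hB]
    have h4 : ∑ i, ∑ j, B i j * ((m i + e i ω) * (m j + e j ω)) =
        c0 + 2 * ∑ i, ∑ j, m i * B i j * e j ω + ∑ i, ∑ j, B i j * (e i ω * e j ω) := by
      have : c0 + 2 * ∑ i, ∑ j, m i * B i j * e j ω + ∑ i, ∑ j, B i j * (e i ω * e j ω) =
        c0 + (∑ i, ∑ j, m i * B i j * e j ω + ∑ i, ∑ j, m j * B i j * e i ω) +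
          ∑ i, ∑ j, B i j * (e i ω * e j ω) := by rw [h3]; ring
      rw [this, hc0]
      simp_rw [← Finset.sum_add_distrib]
      exact Finset.sum_congr rfl fun i _ => Finset.sum_congr rfl fun j _ => by ring
    have h5 : ∑ i, B i i * ((m i + e i ω) * (e i ω - ∑ j, K i j * e j ω)) =
        ∑ j, B j j * m j * e j ω + ∑ i, B i i * (e i ω * e i ω) -
          ∑ i, ∑ j, B i i * m i * K i j * e j ω -
          ∑ i, ∑ j, B i i * K i j * (e i ω * e j ω) := by
      simp_rw [← Finset.sum_add_distrib, ← Finset.sum_sub_distrib]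
      refine Finset.sum_congr rfl fun i _ => ?_
      have e1 : ∑ j, B i i * m i * K i j * e j ω = B i i * m i * ∑ j, K i j * e j ω := by
        rw [Finset.mul_sum]
        exact Finset.sum_congr rfl fun j _ => by ring
      have e2 : ∑ j, B i i * K i j * (e i ω * e j ω) = B i i * e i ω * ∑ j, K i j * e j ω := by
        rw [Finset.mul_sum]
        exact Finset.sum_congr rfl fun j _ => by ring
      rw [e1, e2]
      ring
    rw [h4, h5, h1, h2]
    ring
  -- L and T are centred and uncorrelated, so the contribution of L can simply be dropped from the
  -- lower bound, whatever the signal.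
  have hvar : Var[fun ω => c0 + (L ω + T ω); μ] = ∫ ω, L ω ^ 2 ∂μ + ∫ ω, T ω ^ 2 ∂μ := by
    have hmean : ∫ ω, (L ω + T ω) ∂μ = 0 := by
      rw [integral_add (hLm.integrable one_le_two) (hTm.integrable one_le_two),
        h.integral_linear, h.integral_quadratic hd0, add_zero]
    have hm : AEStronglyMeasurable (fun ω => L ω + T ω) μ := (hLm.add hTm).aestronglyMeasurable
    rw [variance_const_add hm c0, variance_of_integral_eq_zero hm.aemeasurable hmean]
    have iLT : Integrable (fun ω => 2 * (L ω * T ω)) μ := (hLm.integrable_mul hTm).const_mul 2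
    calc ∫ ω, (L ω + T ω) ^ 2 ∂μ = ∫ ω, (L ω ^ 2 + 2 * (L ω * T ω) + T ω ^ 2) ∂μ :=
          integral_congr_ae (ae_of_all _ fun ω => by ring)
      _ = _ := by
          have i1 : Integrable (fun ω => L ω ^ 2 + 2 * (L ω * T ω)) μ :=
            hLm.integrable_sq.add iLT
          rw [integral_add i1 hTm.integrable_sq,
            integral_add hLm.integrable_sq iLT, integral_const_mul,
            h.integral_linear_mul_quadratic a hd0]
          ring
  rw [hdec, hvar]
  have hL0 : 0 ≤ ∫ ω, L ω ^ 2 ∂μ := integral_nonneg fun ω => sq_nonneg _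
  have hT0 := h.le_integral_quadratic_sq (B := B) (c := c) hB (fun i => by simp [hc, hK])
  have hcs : ∑ i, ∑ j, c i j ^ 2 ≤ κ * ∑ i, B i i ^ 2 := by
    rw [Finset.mul_sum]
    refine Finset.sum_le_sum fun i _ => ?_
    simp only [hc, mul_pow, ← Finset.mul_sum]
    rw [mul_comm]
    exact mul_le_mul_of_nonneg_right (hrow i) (sq_nonneg _)
  have : 2 * (1 + C) ^ 2 * ∑ i, ∑ j, c i j ^ 2 ≤ 2 * (1 + C) ^ 2 * (κ * ∑ i, B i i ^ 2) := by
    gcongr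
  linarith

end ErrorBounds

end Moments

/-! ### Central limit theorem through characteristic functions -/

section Lindeberg

lemma norm_exp_mul_I_sub_taylor_le (x : ℝ) :
    ‖Complex.exp (x * Complex.I) - (1 + x * Complex.I - x ^ 2 / 2)‖ ≤ 4 * |x| ^ 3 := by
  have hn : ‖(x : ℂ) * Complex.I‖ = |x| := by simp
  by_cases hx : |x| ≤ 1
  · have h := Complex.exp_bound (x := (x : ℂ) * Complex.I) (by rw [hn]; exact hx)
      (n := 3) (by norm_num)
    have hs : ∑ m ∈ Finset.range 3, ((x : ℂ) * Complex.I) ^ m / (m.factorial : ℂ) =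
        1 + x * Complex.I - x ^ 2 / 2 := by
      simp [Finset.sum_range_succ, mul_pow, Nat.factorial]
      ring
    rw [hs, hn] at h
    refine h.trans ?_
    rw [mul_comm]
    gcongr
    norm_num [Nat.factorial]
  · push Not at hx
    have h1 : ‖Complex.exp (x * Complex.I)‖ = 1 := Complex.norm_exp_ofReal_mul_I x
    have h2 : ‖(x : ℂ) ^ 2 / 2‖ = |x| ^ 2 / 2 := by
      simp [norm_pow]
    calc ‖Complex.exp (x * Complex.I) - (1 + x * Complex.I - x ^ 2 / 2)‖
        ≤ ‖Complex.exp (x * Complex.I)‖ + ((‖(1 : ℂ)‖ + ‖(x : ℂ) * Complex.I‖) +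
          ‖(x : ℂ) ^ 2 / 2‖) := by
          refine (norm_sub_le _ _).trans ?_
          gcongr
          refine (norm_sub_le _ _).trans ?_
          gcongr
          exact norm_add_le _ _
      _ = 2 + |x| + |x| ^ 2 / 2 := by rw [h1, h2, hn, norm_one]; ring
      _ ≤ 4 * |x| ^ 3 := by nlinarith [mul_pos (sub_pos.2 hx) (sub_pos.2 hx), sq_nonneg (|x|)]

lemma abs_exp_neg_sub_le {u : ℝ} (hu : 0 ≤ u) : |Real.exp (-u) - (1 - u)| ≤ u ^ 2 := by
  by_cases h : u ≤ 1
  · have := Real.abs_exp_sub_one_sub_id_le (x := -u) (by rwa [abs_neg, abs_of_nonneg hu])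
    rw [neg_sq] at this
    convert this using 2
    ring
  · push Not at h
    have h1 := Real.exp_pos (-u)
    have h2 : Real.exp (-u) ≤ 1 := Real.exp_le_one_iff.2 (by linarith)
    rw [abs_le]
    constructor <;> nlinarith

/-- Telescoping: exchange one factor at a time, the others having norm at most 1. -/
lemma norm_prod_sub_prod_le {ι : Type*} (s : Finset ι) (f g : ι → ℂ) (hf : ∀ i, ‖f i‖ ≤ 1)
    (hg : ∀ i, ‖g i‖ ≤ 1) : ‖∏ i ∈ s, f i - ∏ i ∈ s, g i‖ ≤ ∑ i ∈ s, ‖f i - g i‖ := by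
  classical
  induction s using Finset.induction_on with
  | empty => simp
  | insert a s ha ih =>
    rw [Finset.prod_insert ha, Finset.prod_insert ha, Finset.sum_insert ha]
    have hp : ‖∏ i ∈ s, f i‖ ≤ 1 := by
      rw [norm_prod]
      exact Finset.prod_le_one (fun _ _ => norm_nonneg _) fun i _ => hf i
    calc ‖f a * ∏ i ∈ s, f i - g a * ∏ i ∈ s, g i‖
        = ‖(f a - g a) * ∏ i ∈ s, f i + g a * (∏ i ∈ s, f i - ∏ i ∈ s, g i)‖ := by ring_nf
      _ ≤ ‖f a - g a‖ * ‖∏ i ∈ s, f i‖ + ‖g a‖ * ‖∏ i ∈ s, f i - ∏ i ∈ s, g i‖ := by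
          refine (norm_add_le _ _).trans ?_
          rw [norm_mul, norm_mul]
      _ ≤ ‖f a - g a‖ * 1 + 1 * ∑ i ∈ s, ‖f i - g i‖ := by
          gcongr
          exact hg a
      _ = _ := by ring

variable {Ω : Type*} [MeasurableSpace Ω] {μ : Measure Ω} [IsProbabilityMeasure μ]

namespace ErrorBounds

variable {n : ℕ} {e : Fin n → Ω → ℝ} {C : ℝ}

lemma integrable_abs_pow_three (h : ErrorBounds μ e C) (i : Fin n) :
    Integrable (fun ω => |e i ω| ^ 3) μ ∧ ∫ ω, |e i ω| ^ 3 ∂μ ≤ 1 + C := by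
  have hb : ∀ ω, |e i ω| ^ 3 ≤ 1 + e i ω ^ 4 := fun ω => by
    rw [← (show Even 4 by decide).pow_abs (e i ω)]
    nlinarith [abs_nonneg (e i ω), sq_nonneg (|e i ω| ^ 2 - |e i ω|), sq_nonneg (|e i ω| - 1),
      sq_nonneg (|e i ω| ^ 2 - 1), sq_nonneg (|e i ω|)]
  have hI : Integrable (fun ω => 1 + e i ω ^ 4) μ := (integrable_const (1 : ℝ)).add (h.integrable i)
  have h3 : Integrable (fun ω => |e i ω| ^ 3) μ := by
    refine hI.mono' ((h.measurable i).abs.pow_const 3).aestronglyMeasurable (ae_of_all _ fun ω => ?_)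
    rw [Real.norm_eq_abs, abs_of_nonneg (by positivity)]
    exact hb ω
  refine ⟨h3, (integral_mono h3 hI hb).trans ?_⟩
  rw [integral_add (integrable_const _) (h.integrable i)]
  simp only [integral_const, probReal_univ, smul_eq_mul, mul_one]
  linarith [h.fourth_le i]

lemma norm_charFun_sub_taylor_le (h : ErrorBounds μ e C) (i : Fin n) (a : ℝ) :
    ‖charFun (μ.map (e i)) a - ((1 - a ^ 2 * (∫ ω, e i ω ^ 2 ∂μ) / 2 : ℝ) : ℂ)‖ ≤
      4 * |a| ^ 3 * (1 + C) := by
  have hm := h.measurable i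
  have hL1 : Integrable (e i) μ := (h.memLp_two i).integrable one_le_two
  have hL2 : Integrable (fun ω => e i ω ^ 2) μ := (h.memLp_two i).integrable_sq
  have i1 : Integrable (fun ω => Complex.exp ((a * e i ω : ℝ) * Complex.I)) μ := by
    refine Integrable.mono' (integrable_const (1 : ℝ)) ?_ (ae_of_all _ fun ω => ?_)
    · exact Measurable.aestronglyMeasurable (by fun_prop)
    · rw [Complex.norm_exp_ofReal_mul_I]
  have i2 : Integrable (fun ω => ((a * e i ω : ℝ) : ℂ) * Complex.I) μ :=
    (hL1.const_mul a).ofReal.mul_const _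
  have i3 : Integrable (fun ω => ((a * e i ω : ℝ) : ℂ) ^ 2 / 2) μ := by
    have : Integrable (fun ω => (((a ^ 2 / 2) * e i ω ^ 2 : ℝ) : ℂ)) μ :=
      (hL2.const_mul (a ^ 2 / 2)).ofReal
    refine this.congr (ae_of_all _ fun ω => ?_)
    push_cast
    ring
  have i4 : Integrable (fun ω => 1 + ((a * e i ω : ℝ) : ℂ) * Complex.I) μ :=
    (integrable_const _).add i2
  have i5 : Integrable (fun ω => 1 + ((a * e i ω : ℝ) : ℂ) * Complex.I -
    ((a * e i ω : ℝ) : ℂ) ^ 2 / 2) μ := i4.sub i3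
  have hchar : charFun (μ.map (e i)) a = ∫ ω, Complex.exp ((a * e i ω : ℝ) * Complex.I) ∂μ := by
    rw [charFun_apply_real, integral_map hm.aemeasurable
      (Measurable.aestronglyMeasurable (by fun_prop))]
    simp
  have hE : ∫ ω, (1 + ((a * e i ω : ℝ) : ℂ) * Complex.I - ((a * e i ω : ℝ) : ℂ) ^ 2 / 2) ∂μ =
      ((1 - a ^ 2 * (∫ ω, e i ω ^ 2 ∂μ) / 2 : ℝ) : ℂ) := by
    have e3 : ∫ ω, ((a * e i ω : ℝ) : ℂ) ^ 2 / 2 ∂μ =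
        ((a ^ 2 / 2 * ∫ ω, e i ω ^ 2 ∂μ : ℝ) : ℂ) := by
      rw [← integral_const_mul, ← integral_complex_ofReal]
      refine integral_congr_ae (ae_of_all _ fun ω => ?_)
      push_cast
      ring
    rw [integral_sub i4 i3, integral_add (integrable_const _) i2, integral_mul_const,
      integral_complex_ofReal, integral_const_mul, h.mean i, e3]
    simp
    ring
  rw [hchar, ← hE, ← integral_sub i1 i5]
  calc _ ≤ ∫ ω, 4 * |a| ^ 3 * |e i ω| ^ 3 ∂μ := by
        refine norm_integral_le_of_norm_le ((h.integrable_abs_pow_three i).1.const_mul _)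
          (ae_of_all _ fun ω => ?_)
        refine (norm_exp_mul_I_sub_taylor_le (a * e i ω)).trans_eq ?_
        rw [abs_mul, mul_pow, mul_assoc]
    _ ≤ _ := by
        rw [integral_const_mul]
        gcongr
        exact (h.integrable_abs_pow_three i).2

/-- A quantitative Lindeberg estimate for the characteristic function of `∑ᵢ aᵢ εᵢ`. -/
lemma norm_integral_exp_linear_sub_le (h : ErrorBounds μ e C) {a : Fin n → ℝ} {η : ℝ}
    (ha : ∀ i, |a i| ≤ η) (hη : η ≤ 1) :
    ‖∫ ω, Complex.exp ((∑ i, a i * e i ω : ℝ) * Complex.I) ∂μ -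
      (Real.exp (-(∑ i, a i ^ 2 * ∫ ω, e i ω ^ 2 ∂μ) / 2) : ℂ)‖ ≤
      η * (4 * (1 + C) * C + (1 + C)) * ∑ i, a i ^ 2 * ∫ ω, e i ω ^ 2 ∂μ := by
  set s : Fin n → ℝ := fun i => ∫ ω, e i ω ^ 2 ∂μ with hs
  have hs0 : ∀ i, 0 < s i := h.var_pos
  have hind : iIndepFun (fun i ω => a i * e i ω) μ :=
    h.indep.comp (fun i t => a i * t) fun i => measurable_const_mul _
  have hprod : ∫ ω, Complex.exp ((∑ i, a i * e i ω : ℝ) * Complex.I) ∂μ =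
      ∏ i, charFun (μ.map (e i)) (a i) := by
    have h1 := hind.charFun_map_fun_sum_eq_prod
      (fun i => ((h.measurable i).const_mul (a i)).aemeasurable)
    have h2 := congrFun h1 1
    rw [charFun_apply_real, integral_map
      (Finset.measurable_sum _ fun i _ => (h.measurable i).const_mul (a i)).aemeasurable
      (Measurable.aestronglyMeasurable (by fun_prop)), Finset.prod_apply] at h2
    simp only [charFun_map_mul_comp (h.measurable _).aemeasurable, mul_one] at h2
    rw [← h2]
    simp
  have hexp : (Real.exp (-(∑ i, a i ^ 2 * s i) / 2) : ℂ) =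
      ∏ i, ((Real.exp (-(a i ^ 2 * s i / 2)) : ℝ) : ℂ) := by
    rw [← Complex.ofReal_prod, ← Real.exp_sum]
    congr 2
    rw [Finset.sum_neg_distrib, neg_div, Finset.sum_div]
  rw [hprod, hexp]
  have hf : ∀ i, ‖charFun (μ.map (e i)) (a i)‖ ≤ 1 := fun i => by
    have := Measure.isProbabilityMeasure_map (μ := μ) (h.measurable i).aemeasurable
    exact norm_charFun_le_one _
  have hg : ∀ i, ‖((Real.exp (-(a i ^ 2 * s i / 2)) : ℝ) : ℂ)‖ ≤ 1 := fun i => by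
    rw [Complex.norm_real, Real.norm_eq_abs, abs_of_pos (Real.exp_pos _), Real.exp_le_one_iff]
    have := hs0 i
    have : 0 ≤ a i ^ 2 * s i / 2 := by positivity
    linarith
  refine (norm_prod_sub_prod_le _ _ _ hf hg).trans ?_
  rw [Finset.mul_sum]
  refine Finset.sum_le_sum fun i _ => ?_
  have hC := h.pos i
  have hη0 : 0 ≤ η := (abs_nonneg _).trans (ha i)
  have hu : 0 ≤ a i ^ 2 * s i / 2 := by have := hs0 i; positivity
  -- The lower bound on the variances turns aᵢ² into a multiple of aᵢ²σᵢ², so that the errors add up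
  -- to the total variance.
  have hCs : 1 ≤ C * s i := by
    have := h.inv_le_var i
    calc (1 : ℝ) = C * C⁻¹ := (mul_inv_cancel₀ hC.ne').symm
      _ ≤ C * s i := by gcongr
  have t1 : 4 * |a i| ^ 3 * (1 + C) ≤ η * (4 * (1 + C) * C) * (a i ^ 2 * s i) := by
    calc 4 * |a i| ^ 3 * (1 + C) = |a i| * (4 * (1 + C)) * (a i ^ 2 * 1) := by
          rw [← sq_abs (a i)]; ring
      _ ≤ η * (4 * (1 + C)) * (a i ^ 2 * (C * s i)) := by gcongr; exact ha i
      _ = _ := by ring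
  have t2 : (a i ^ 2 * s i / 2) ^ 2 ≤ η * (1 + C) * (a i ^ 2 * s i) := by
    have q1 : a i ^ 2 ≤ η := by
      rw [← sq_abs]
      calc |a i| ^ 2 ≤ η ^ 2 := by gcongr; exact ha i
        _ ≤ η := by nlinarith
    have q2 : s i ≤ 1 + C := h.var_le i
    have q3 : a i ^ 2 * s i ≤ η * (1 + C) := mul_le_mul q1 q2 (hs0 i).le hη0
    nlinarith
  calc ‖charFun (μ.map (e i)) (a i) - ((Real.exp (-(a i ^ 2 * s i / 2)) : ℝ) : ℂ)‖
      ≤ ‖charFun (μ.map (e i)) (a i) - ((1 - a i ^ 2 * s i / 2 : ℝ) : ℂ)‖ +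
        ‖((1 - a i ^ 2 * s i / 2 : ℝ) : ℂ) - ((Real.exp (-(a i ^ 2 * s i / 2)) : ℝ) : ℂ)‖ :=
        norm_sub_le_norm_sub_add_norm_sub _ _ _
    _ ≤ 4 * |a i| ^ 3 * (1 + C) + (a i ^ 2 * s i / 2) ^ 2 := by
        refine add_le_add (h.norm_charFun_sub_taylor_le i (a i)) ?_
        rw [← Complex.ofReal_sub, Complex.norm_real, Real.norm_eq_abs, abs_sub_comm]
        exact abs_exp_neg_sub_le hu
    _ ≤ _ := by linarith

end ErrorBounds

/-- **Lindeberg central limit theorem** for weighted sums of a triangular array of errors. -/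
theorem tendstoInDistribution_of_inner_eq_linear {E : Type*} [NormedAddCommGroup E]
    [InnerProductSpace ℝ E] [FiniteDimensional ℝ E] [MeasurableSpace E] [BorelSpace E]
    {ν : Measure E} [IsProbabilityMeasure ν]
    (hν : ∀ t : E, charFun ν t = Complex.exp (-‖t‖ ^ 2 / 2))
    {X : ℕ → Ω → E} (hX : ∀ n, AEMeasurable (X n) μ) {e : ∀ n, Fin n → Ω → ℝ} {C : ℝ}
    (he : ∀ᶠ n in atTop, ErrorBounds μ (e n) C) {η : ℕ → ℝ} (hη : Tendsto η atTop (𝓝 0))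
    {a : ∀ n, E → Fin n → ℝ}
    (ha : ∀ᶠ n in atTop, ∀ t : E, (∀ ω, inner ℝ (X n ω) t = ∑ i, a n t i * e n i ω) ∧
      ∑ i, a n t i ^ 2 * ∫ ω, e n i ω ^ 2 ∂μ = ‖t‖ ^ 2 ∧ ∀ i, |a n t i| ≤ ‖t‖ * η n) :
    TendstoInDistribution X atTop id (fun _ => μ) ν where
  forall_aemeasurable := hX
  aemeasurable_limit := aemeasurable_id
  tendsto := by
    -- Lévy's continuity theorem reduces the vector statement to scalar linear forms, one for each
    -- fixed t.
    refine ProbabilityMeasure.tendsto_iff_tendsto_charFun.2 fun t => ?_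
    simp only [ProbabilityMeasure.coe_mk, Measure.map_id]
    rw [hν, tendsto_iff_norm_sub_tendsto_zero]
    have hlim : Tendsto (fun n => ‖t‖ * η n * (4 * (1 + C) * C + (1 + C)) * ‖t‖ ^ 2) atTop
        (𝓝 0) := by
      have := ((hη.const_mul ‖t‖).mul_const (4 * (1 + C) * C + (1 + C))).mul_const (‖t‖ ^ 2)
      simpa using this
    have hsmall : ∀ᶠ n in atTop, ‖t‖ * η n ≤ 1 := by
      have : Tendsto (fun n => ‖t‖ * η n) atTop (𝓝 0) := by simpa using hη.const_mul ‖t‖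
      exact (this.eventually (gt_mem_nhds one_pos)).mono fun n hn => hn.le
    refine squeeze_zero' (.of_forall fun _ => norm_nonneg _) ?_ hlim
    filter_upwards [he, ha, hsmall] with n hen han hsn
    obtain ⟨h1, h2, h3⟩ := han t
    have hb := hen.norm_integral_exp_linear_sub_le h3 hsn
    rw [h2] at hb
    have hc : charFun (μ.map (X n)) t =
        ∫ ω, Complex.exp ((∑ i, a n t i * e n i ω : ℝ) * Complex.I) ∂μ := by
      rw [charFun_apply, integral_map (hX n) (Measurable.aestronglyMeasurable (by fun_prop))]
      simp_rw [h1]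
    have hexp : Complex.exp (-(‖t‖ : ℂ) ^ 2 / 2) = ((Real.exp (-‖t‖ ^ 2 / 2) : ℝ) : ℂ) := by
      rw [Complex.ofReal_exp]
      simp
    rw [hc, hexp]
    exact hb

end Lindeberg

/-! ### Bounds for the estimators at a fixed sample size -/

section FixedSampleSize

variable {Ω : Type*} [MeasurableSpace Ω] {μ : Measure Ω} {n k r : ℕ}

/-- The regression model with its regularity conditions for one sample size `n`; `η` bounds the
squared norms of the weights `wᵢ`. -/
structure RegularModel (μ : Measure Ω) (x : Fin n → Fin k → ℝ) (β : Fin k → ℝ)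
    (A : Matrix (Fin k) (Fin k) ℝ) (Q : Matrix (Fin k) (Fin r) ℝ) (lam : Fin r → ℝ)
    (e : Fin n → Ω → ℝ) (y : Ω → Fin n → ℝ) (C c D η : ℝ) : Prop where
  errors : ErrorBounds μ e C
  pos : 0 < C
  model : ∀ ω i, y ω i = x i ⬝ᵥ β + e i ω
  isUnit : IsUnit (Sxx x)
  isSymm : A.IsSymm
  spectral : IsSpectralDecomposition (Atilde x A) Q lam
  lt_one : c < 1
  leverage_le : ∀ i, leverage x i ≤ c
  signal_le : ∀ i, (x i ⬝ᵥ β) ^ 2 ≤ D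
  weight_le : ∀ i, w x Q i ⬝ᵥ w x Q i ≤ η

/-- The constant in the second moment bound for `∑ᵢ gᵢ (σ̂ᵢ² - σᵢ²)`. -/
def momentConst (C c D : ℝ) : ℝ :=
  3 * (C + (1 + C) * (2 * D + 8 * ((1 - c)⁻¹) ^ 2 * D) + 2 * (1 + C) ^ 2 * ((1 - c)⁻¹) ^ 2)

lemma momentConst_nonneg {C c D : ℝ} (hC : 0 < C) (hD : 0 ≤ D) : 0 ≤ momentConst C c D := by
  unfold momentConst
  positivity

namespace RegularModel

variable {x : Fin n → Fin k → ℝ} {β : Fin k → ℝ} {A : Matrix (Fin k) (Fin k) ℝ}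
  {Q : Matrix (Fin k) (Fin r) ℝ} {lam : Fin r → ℝ} {e : Fin n → Ω → ℝ} {y : Ω → Fin n → ℝ}
  {C c D η : ℝ}

lemma hatMatrix_le (h : RegularModel μ x β A Q lam e y C c D η) (i : Fin n) :
    hatMatrix x i i ≤ c :=
  (leverage_eq x i).symm.trans_le (h.leverage_le i)

lemma sigmaSqHat_eq (h : RegularModel μ x β A Q lam e y C c D η) (ω : Ω) (i : Fin n) :
    sigmaSqHat x (y ω) i = (x i ⬝ᵥ β + e i ω) * (e i ω - ∑ l, looWeight x i l * e l ω) :=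
  LeaveOut.sigmaSqHat_eq h.isUnit β (e := fun i => e i ω) (h.model ω)
    ((h.hatMatrix_le i).trans_lt h.lt_one).ne

lemma bHat_sub (h : RegularModel μ x β A Q lam e y C c D η) (ω : Ω) :
    bHat x Q (y ω) - b x Q β = ∑ i, e i ω • w x Q i := by
  ext l
  rw [Pi.sub_apply, bHat_eq_add h.isUnit Q β (e := fun i => e i ω) (h.model ω) l,
    add_sub_cancel_left]
  simp [Finset.sum_apply, mul_comm]

variable [IsProbabilityMeasure μ]

lemma integral_sum_sigmaSqHat_sub_sq_le (h : RegularModel μ x β A Q lam e y C c D η)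
    (g : Fin n → ℝ) :
    MemLp (fun ω => ∑ i, g i * (sigmaSqHat x (y ω) i - ∫ ω', e i ω' ^ 2 ∂μ)) 2 μ ∧
    ∫ ω, (∑ i, g i * (sigmaSqHat x (y ω) i - ∫ ω', e i ω' ^ 2 ∂μ)) ^ 2 ∂μ ≤
      momentConst C c D * ∑ i, g i ^ 2 := by
  simp_rw [h.sigmaSqHat_eq]
  exact h.errors.integral_sum_estimate_sub_sq_le (looWeight_self x)
    (fun i => sum_looWeight_sq_le h.isUnit h.lt_one (h.hatMatrix_le i))
    (sum_sq_sum_mul_looWeight_le h.isUnit h.lt_one h.hatMatrix_le) h.signal_le g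

lemma le_variance_thetaHat (h : RegularModel μ x β A Q lam e y C c D η) :
    (C⁻¹) ^ 2 * (∑ l, lam l ^ 2 - ∑ i, Bdiag x A i ^ 2) -
      2 * (1 + C) ^ 2 * (((1 - c)⁻¹) ^ 2 * ∑ i, Bdiag x A i ^ 2) ≤
    Var[fun ω => thetaHat x A (y ω); μ] := by
  have hv := h.errors.le_variance_quadratic_sub_estimate (m := fun i => x i ⬝ᵥ β)
    (looWeight_self x)
    (fun i => sum_looWeight_sq_le h.isUnit h.lt_one (h.hatMatrix_le i))
    (Bmatrix_comm (x := x) h.isSymm)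
  rw [sum_Bmatrix_sq h.isUnit h.spectral] at hv
  simp_rw [Bdiag_eq]
  convert hv using 2
  funext ω
  rw [thetaHat, betaHat_quadratic]
  simp_rw [h.sigmaSqHat_eq, h.model, Bdiag_eq]

lemma cov_bHat (h : RegularModel μ x β A Q lam e y C c D η) (l m : Fin r) :
    cov[fun ω => bHat x Q (y ω) l, fun ω => bHat x Q (y ω) m; μ] =
      ∑ i, w x Q i l * w x Q i m * ∫ ω, e i ω ^ 2 ∂μ := by
  have hb : ∀ l, (fun ω => bHat x Q (y ω) l) =
      fun ω => b x Q β l + ∑ i, w x Q i l * e i ω := fun l =>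
    funext fun ω => bHat_eq_add h.isUnit Q β (e := fun i => e i ω) (h.model ω) l
  have hmean : ∀ l, ∫ ω, b x Q β l + ∑ i, w x Q i l * e i ω ∂μ = b x Q β l := fun l => by
    rw [integral_add (integrable_const _)
      ((h.errors.memLp_linear fun i => w x Q i l).integrable one_le_two),
      h.errors.integral_linear]
    simp
  rw [hb, hb, covariance]
  simp only [hmean, add_sub_cancel_left]
  exact h.errors.integral_linear_mul_linear (fun i => w x Q i l) fun i => w x Q i m

lemma varMatrix_bHat_apply (h : RegularModel μ x β A Q lam e y C c D η) (l m : Fin r) :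
    varMatrix μ (fun ω => bHat x Q (y ω)) l m =
      ∑ i, w x Q i l * w x Q i m * ∫ ω, e i ω ^ 2 ∂μ :=
  h.cov_bHat l m

lemma variance_bHat (h : RegularModel μ x β A Q lam e y C c D η) (l : Fin r) :
    Var[fun ω => bHat x Q (y ω) l; μ] = ∑ i, w x Q i l * w x Q i l * ∫ ω, e i ω ^ 2 ∂μ := by
  rw [← h.cov_bHat, covariance_self]
  have hb : (fun ω => bHat x Q (y ω) l) =
      fun ω => b x Q β l + ∑ i, w x Q i l * e i ω :=
    funext fun ω => bHat_eq_add h.isUnit Q β (e := fun i => e i ω) (h.model ω) l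
  rw [hb]
  exact ((h.errors.memLp_linear fun i => w x Q i l).aestronglyMeasurable.aemeasurable).const_add _

/-- Since Bᵢᵢ = ∑ λₗ wᵢₗ², the centring ∑ λₗ V[b̂ₗ] equals ∑ Bᵢᵢσᵢ², while β̂'Aβ̂ = ∑ λₗ b̂ₗ² holds
exactly. Only the errors in estimating σᵢ² remain. -/
lemma thetaHat_sub (h : RegularModel μ x β A Q lam e y C c D η) (ω : Ω) :
    thetaHat x A (y ω) - ∑ l, lam l * (bHat x Q (y ω) l ^ 2 -
      Var[fun ω' => bHat x Q (y ω') l; μ]) =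
    -∑ i, Bdiag x A i * (sigmaSqHat x (y ω) i - ∫ ω', e i ω' ^ 2 ∂μ) := by
  have h1 : ∑ l, lam l * Var[fun ω' => bHat x Q (y ω') l; μ] =
      ∑ i, Bdiag x A i * ∫ ω', e i ω' ^ 2 ∂μ := by
    simp_rw [h.variance_bHat, Bdiag_eq, Bmatrix_apply_eq_sum h.isUnit h.spectral,
      Finset.sum_mul, Finset.mul_sum]
    rw [Finset.sum_comm]
    simp only [mul_assoc]
  rw [thetaHat, betaHat_quadratic_eq_sum h.isUnit h.spectral]
  simp_rw [mul_sub, Finset.sum_sub_distrib]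
  rw [h1]
  ring

lemma varMatrix_bHat_mulVec (h : RegularModel μ x β A Q lam e y C c D η) (u v : Fin r → ℝ) :
    u ⬝ᵥ (varMatrix μ (fun ω => bHat x Q (y ω)) *ᵥ v) =
      ∑ i, (u ⬝ᵥ w x Q i) * (v ⬝ᵥ w x Q i) * ∫ ω, e i ω ^ 2 ∂μ := by
  simp only [dotProduct, mulVec, h.varMatrix_bHat_apply, Finset.mul_sum, Finset.sum_mul]
  rw [Finset.sum_comm]
  simp_rw [Finset.sum_comm (s := (Finset.univ : Finset (Fin r))) (t := (Finset.univ : Finset (Fin n)))]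
  refine Finset.sum_congr rfl fun i _ => Finset.sum_congr rfl fun l _ =>
    Finset.sum_congr rfl fun m _ => by ring

/-- V[b̂] = ∑ σᵢ² wᵢwᵢ' dominates C⁻¹ ∑ wᵢwᵢ' = C⁻¹ I. -/
lemma le_varMatrix_bHat (h : RegularModel μ x β A Q lam e y C c D η) (u : Fin r → ℝ) :
    u ⬝ᵥ u ≤ C * (u ⬝ᵥ (varMatrix μ (fun ω => bHat x Q (y ω)) *ᵥ u)) := by
  have h1 : u ⬝ᵥ u = ∑ i, (u ⬝ᵥ w x Q i) ^ 2 := by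
    have hW := wMatrix_transpose_mul_self h.isUnit h.spectral.orthonormal
    have h2 : (wMatrix x Q *ᵥ u) ⬝ᵥ (wMatrix x Q *ᵥ u) = u ⬝ᵥ u := by
      rw [dotProduct_mulVec, ← vecMul_transpose, vecMul_vecMul, hW, vecMul_one]
    rw [← h2]
    simp only [dotProduct, mulVec, wMatrix, of_apply, sq]
    exact Finset.sum_congr rfl fun i _ => by simp only [mul_comm]
  rw [h1, h.varMatrix_bHat_mulVec, Finset.mul_sum]
  refine Finset.sum_le_sum fun i _ => ?_
  have hi := h.errors.inv_le_var i
  have : 1 ≤ C * ∫ ω, e i ω ^ 2 ∂μ := by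
    calc (1 : ℝ) = C * C⁻¹ := (mul_inv_cancel₀ h.pos.ne').symm
      _ ≤ _ := mul_le_mul_of_nonneg_left hi h.pos.le
  nlinarith [sq_nonneg (u ⬝ᵥ w x Q i)]

lemma posDef_varMatrix_bHat (h : RegularModel μ x β A Q lam e y C c D η) :
    (varMatrix μ fun ω => bHat x Q (y ω)).PosDef := by
  refine PosDef.of_dotProduct_mulVec_pos ?_ fun u hu => ?_
  · ext l m
    simp only [conjTranspose_apply, h.varMatrix_bHat_apply, star_trivial]
    exact Finset.sum_congr rfl fun i _ => by ring
  · have h1 : 0 < u ⬝ᵥ u := by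
      simpa using dotProduct_star_self_pos_iff.2 hu
    have h2 := h1.trans_le (h.le_varMatrix_bHat u)
    simpa using pos_of_mul_pos_right h2 h.pos.le

lemma inv_varMatrix_mulVec_le (h : RegularModel μ x β A Q lam e y C c D η) (v : Fin r → ℝ) :
    ((varMatrix μ fun ω => bHat x Q (y ω))⁻¹ *ᵥ v) ⬝ᵥ
      ((varMatrix μ fun ω => bHat x Q (y ω))⁻¹ *ᵥ v) ≤ C ^ 2 * (v ⬝ᵥ v) := by
  set V := varMatrix μ fun ω => bHat x Q (y ω) with hV
  set u := V⁻¹ *ᵥ v with hu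
  have hdet : IsUnit V.det := (isUnit_iff_isUnit_det _).1 h.posDef_varMatrix_bHat.isUnit
  have hVu : V *ᵥ u = v := by rw [hu, mulVec_mulVec, mul_nonsing_inv _ hdet, one_mulVec]
  have h1 := h.le_varMatrix_bHat u
  rw [← hV, hVu] at h1
  -- Combined with |u|² ≤ C ⟨u, v⟩ this gives |u|² ≤ C²|v|² without taking norms of V⁻¹.
  have h2 : 0 ≤ (C • v - u) ⬝ᵥ (C • v - u) := dotProduct_self_nonneg' _
  rw [sub_dotProduct, dotProduct_sub, dotProduct_sub, smul_dotProduct, dotProduct_smul,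
    dotProduct_smul, smul_dotProduct, dotProduct_comm v u] at h2
  simp only [smul_eq_mul] at h2
  nlinarith

/-- The weights in the expansion of an entry of `V[b̂]⁻¹ V̂[b̂] - I`. -/
lemma inv_varMatrix_mul_varHatB_sub (h : RegularModel μ x β A Q lam e y C c D η) (l m : Fin r)
    (ω : Ω) :
    ((varMatrix μ fun ω => bHat x Q (y ω))⁻¹ * varHatB x Q (y ω)) l m -
      (1 : Matrix (Fin r) (Fin r) ℝ) l m =
    ∑ i, ((varMatrix μ fun ω => bHat x Q (y ω))⁻¹ *ᵥ w x Q i) l * w x Q i m *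
      (sigmaSqHat x (y ω) i - ∫ ω', e i ω' ^ 2 ∂μ) := by
  set V := varMatrix μ fun ω => bHat x Q (y ω) with hV
  have hdet : IsUnit V.det := (isUnit_iff_isUnit_det _).1 h.posDef_varMatrix_bHat.isUnit
  have key : ∀ s : Fin n → ℝ, (V⁻¹ * ∑ i, s i • vecMulVec (w x Q i) (w x Q i)) l m =
      ∑ i, (V⁻¹ *ᵥ w x Q i) l * w x Q i m * s i := by
    intro s
    rw [Matrix.mul_sum, Matrix.sum_apply]
    refine Finset.sum_congr rfl fun i _ => ?_
    rw [Matrix.mul_smul, mul_vecMulVec, Matrix.smul_apply, vecMulVec_apply, smul_eq_mul]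
    ring
  have hVs : V = ∑ i, (∫ ω', e i ω' ^ 2 ∂μ) • vecMulVec (w x Q i) (w x Q i) := by
    ext a b
    rw [hV, h.varMatrix_bHat_apply, Matrix.sum_apply]
    refine Finset.sum_congr rfl fun i _ => ?_
    rw [Matrix.smul_apply, vecMulVec_apply, smul_eq_mul]
    ring
  have h1 : (1 : Matrix (Fin r) (Fin r) ℝ) l m =
      ∑ i, (V⁻¹ *ᵥ w x Q i) l * w x Q i m * ∫ ω', e i ω' ^ 2 ∂μ := by
    rw [← key, ← hVs, nonsing_inv_mul _ hdet]
  rw [varHatB, key, h1]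
  simp_rw [mul_sub, Finset.sum_sub_distrib]

lemma sq_apply_le_dotProduct (v : Fin r → ℝ) (l : Fin r) : v l ^ 2 ≤ v ⬝ᵥ v := by
  rw [sq]
  exact Finset.single_le_sum (f := fun i => v i * v i) (fun i _ => mul_self_nonneg _)
    (Finset.mem_univ l)

lemma sum_weight_sq_le (h : RegularModel μ x β A Q lam e y C c D η) (l m : Fin r) :
    ∑ i, (((varMatrix μ fun ω => bHat x Q (y ω))⁻¹ *ᵥ w x Q i) l * w x Q i m) ^ 2 ≤
      C ^ 2 * (η * r) := by
  refine le_trans ?_ (mul_le_mul_of_nonneg_left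
    (sum_w_dotProduct_self_sq_le h.isUnit h.spectral.orthonormal h.weight_le) (sq_nonneg C))
  rw [Finset.mul_sum]
  refine Finset.sum_le_sum fun i _ => ?_
  rw [mul_pow, sq (_ ⬝ᵥ _), ← mul_assoc]
  exact mul_le_mul ((sq_apply_le_dotProduct _ l).trans (h.inv_varMatrix_mulVec_le _))
    (sq_apply_le_dotProduct _ m) (sq_nonneg _)
    (mul_nonneg (sq_nonneg _) (dotProduct_self_nonneg' _))

/-- The linear representation of `⟨t, V[b̂]^{-1/2} (b̂ - b)⟩`. -/
lemma inner_standardized (h : RegularModel μ x β A Q lam e y C c D η)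
    (t : EuclideanSpace ℝ (Fin r)) :
    (∀ ω, inner ℝ (WithLp.toLp 2 ((CFC.sqrt (varMatrix μ fun ω' => bHat x Q (y ω')))⁻¹ *ᵥ
      (bHat x Q (y ω) - b x Q β))) t =
      ∑ i, (((CFC.sqrt (varMatrix μ fun ω' => bHat x Q (y ω')))⁻¹ *ᵥ t.ofLp) ⬝ᵥ w x Q i) *
        e i ω) ∧
    ∑ i, (((CFC.sqrt (varMatrix μ fun ω' => bHat x Q (y ω')))⁻¹ *ᵥ t.ofLp) ⬝ᵥ w x Q i) ^ 2 *
        ∫ ω, e i ω ^ 2 ∂μ = ‖t‖ ^ 2 ∧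
    ∀ i, |((CFC.sqrt (varMatrix μ fun ω' => bHat x Q (y ω')))⁻¹ *ᵥ t.ofLp) ⬝ᵥ w x Q i| ≤
      ‖t‖ * √(C * η) := by
  have hle := h.le_varMatrix_bHat
  have hpd := h.posDef_varMatrix_bHat
  have hqf := h.varMatrix_bHat_mulVec
  set V := varMatrix μ fun ω => bHat x Q (y ω) with hV
  set R := (CFC.sqrt V)⁻¹ with hR
  have hRt : Rᵀ = R := sqrt_inv_transpose V
  set s := R *ᵥ t.ofLp with hs
  have hnorm : ‖t‖ ^ 2 = t.ofLp ⬝ᵥ t.ofLp := by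
    rw [EuclideanSpace.norm_sq_eq]
    simp [dotProduct, sq]
  have hsV : s ⬝ᵥ (V *ᵥ s) = ‖t‖ ^ 2 := by
    have hone := sqrt_inv_mul_self_mul_sqrt_inv hpd.posSemidef hpd.isUnit
    rw [hnorm, hs]
    conv_lhs => lhs; rw [← hRt, mulVec_transpose]
    rw [← dotProduct_mulVec, mulVec_mulVec, mulVec_mulVec, hone, one_mulVec]
  refine ⟨fun ω => ?_, ?_, fun i => ?_⟩
  · rw [h.bHat_sub, EuclideanSpace.inner_eq_star_dotProduct]
    simp only [star_trivial]
    rw [dotProduct_mulVec, ← mulVec_transpose, hRt, ← hs, dotProduct_sum]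
    refine Finset.sum_congr rfl fun i _ => ?_
    rw [dotProduct_smul, smul_eq_mul, mul_comm]
  · rw [← hsV, hqf]
    simp only [sq]
  · refine abs_le_of_sq_le_sq ?_ (by positivity)
    have hη : 0 ≤ η := (dotProduct_self_nonneg' _).trans (h.weight_le i)
    rw [mul_pow, Real.sq_sqrt (mul_nonneg h.pos.le hη)]
    -- Cauchy–Schwarz, followed by |s|² ≤ C s'Vs = C|t|² because s = V^{-1/2} t.
    calc (s ⬝ᵥ w x Q i) ^ 2 ≤ (s ⬝ᵥ s) * (w x Q i ⬝ᵥ w x Q i) := by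
          simp only [dotProduct, ← sq]
          exact Finset.sum_mul_sq_le_sq_mul_sq _ _ _
      _ ≤ (C * ‖t‖ ^ 2) * η := by
          have := hle s
          rw [hsV] at this
          exact mul_le_mul this (h.weight_le i) (dotProduct_self_nonneg' _)
            (mul_nonneg h.pos.le (sq_nonneg _))
      _ = _ := by ring

end RegularModel

end FixedSampleSize

/-! ### Linear contrasts: the rank-one case A = vv' -/

section Contrast

variable {Ω : Type*} [MeasurableSpace Ω] {μ : Measure Ω} {n k r : ℕ}

/-- The weights `aᵢ = xᵢ' S_xx⁻¹ v` of the OLS estimator `v'β̂ = ∑ᵢ aᵢ yᵢ`. -/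
def contrastWeight (x : Fin n → Fin k → ℝ) (v : Fin k → ℝ) (i : Fin n) : ℝ :=
  x i ⬝ᵥ ((Sxx x)⁻¹ *ᵥ v)

lemma dotProduct_inv_mulVec (x : Fin n → Fin k → ℝ) (v u : Fin k → ℝ) :
    v ⬝ᵥ ((Sxx x)⁻¹ *ᵥ u) = u ⬝ᵥ ((Sxx x)⁻¹ *ᵥ v) := by
  rw [dotProduct_mulVec, ← mulVec_transpose, Sxx_inv_transpose, dotProduct_comm]

lemma Bmatrix_vecMulVec (x : Fin n → Fin k → ℝ) (v : Fin k → ℝ) (i j : Fin n) :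
    Bmatrix x (vecMulVec v v) i j = contrastWeight x v i * contrastWeight x v j := by
  rw [Bmatrix_apply, mul_vecMulVec, ← mulVec_mulVec, vecMulVec_mulVec, op_smul_eq_smul,
    dotProduct_smul, smul_eq_mul, dotProduct_inv_mulVec x v, mul_comm]
  rfl

lemma contrastWeight_sq (x : Fin n → Fin k → ℝ) (v : Fin k → ℝ) (i : Fin n) :
    contrastWeight x v i ^ 2 = Bdiag x (vecMulVec v v) i := by
  rw [Bdiag_eq, Bmatrix_vecMulVec, sq]

lemma dotProduct_varHatBeta (x : Fin n → Fin k → ℝ) (v : Fin k → ℝ) (y : Fin n → ℝ) :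
    v ⬝ᵥ (varHatBeta x y *ᵥ v) = ∑ i, contrastWeight x v i ^ 2 * sigmaSqHat x y i := by
  rw [varHatBeta, ← mulVec_mulVec, ← mulVec_mulVec, dotProduct_inv_mulVec, sum_mulVec,
    sum_dotProduct]
  refine Finset.sum_congr rfl fun i _ => ?_
  rw [smul_mulVec, vecMulVec_mulVec, op_smul_eq_smul, smul_dotProduct, smul_dotProduct]
  simp only [contrastWeight, smul_eq_mul]
  ring

/-- The vector v is recovered as ∑ aᵢxᵢ, so the weights cannot all vanish. -/
lemma sum_contrastWeight_sq_pos {x : Fin n → Fin k → ℝ} (hS : IsUnit (Sxx x)) {v : Fin k → ℝ}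
    (hv : v ≠ 0) : 0 < ∑ i, contrastWeight x v i ^ 2 := by
  refine lt_of_le_of_ne (by positivity) fun h0 => hv ?_
  have hz : ∀ i, contrastWeight x v i = 0 := fun i => by
    have := (Finset.sum_eq_zero_iff_of_nonneg fun i _ => sq_nonneg _).1 h0.symm i
      (Finset.mem_univ i)
    exact pow_eq_zero_iff two_ne_zero |>.1 this
  have hdet := (isUnit_iff_isUnit_det _).1 hS
  calc v = (Sxx x * (Sxx x)⁻¹) *ᵥ v := by rw [mul_nonsing_inv _ hdet, one_mulVec]
    _ = ∑ i, contrastWeight x v i • x i := by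
        rw [← mulVec_mulVec]
        conv_lhs => lhs; rw [Sxx]
        rw [sum_mulVec]
        refine Finset.sum_congr rfl fun i _ => ?_
        rw [vecMulVec_mulVec, op_smul_eq_smul]
        rfl
    _ = 0 := by simp [hz]

namespace RegularModel

variable {x : Fin n → Fin k → ℝ} {β : Fin k → ℝ} {v : Fin k → ℝ}
  {Q : Matrix (Fin k) (Fin r) ℝ} {lam : Fin r → ℝ} {e : Fin n → Ω → ℝ} {y : Ω → Fin n → ℝ}
  {C c D η : ℝ}

lemma dotProduct_betaHat_sub (h : RegularModel μ x β (vecMulVec v v) Q lam e y C c D η) (ω : Ω) :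
    v ⬝ᵥ (betaHat x (y ω) - β) = ∑ i, contrastWeight x v i * e i ω := by
  have hdet := (isUnit_iff_isUnit_det _).1 h.isUnit
  have hsum : ∑ i, y ω i • x i = Sxx x *ᵥ β + ∑ i, e i ω • x i := by
    conv_rhs => lhs; rw [Sxx]
    rw [sum_mulVec, ← Finset.sum_add_distrib]
    refine Finset.sum_congr rfl fun i _ => ?_
    rw [vecMulVec_mulVec, op_smul_eq_smul, ← add_smul, ← h.model]
  rw [betaHat, hsum, mulVec_add, mulVec_mulVec, nonsing_inv_mul _ hdet, one_mulVec,
    add_sub_cancel_left, dotProduct_inv_mulVec, sum_dotProduct]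
  refine Finset.sum_congr rfl fun i _ => ?_
  rw [smul_dotProduct, smul_eq_mul, mul_comm]
  rfl

/-- For A = vv' the form has Bᵢⱼ = aᵢaⱼ, so ∑ λ² = (∑ aⱼ²)² and the bound on Bᵢᵢ² is the square of
the claim. Neither r = 1 nor the eigenvector need be identified. -/
lemma contrastWeight_sq_le (h : RegularModel μ x β (vecMulVec v v) Q lam e y C c D η)
    (i : Fin n) :
    contrastWeight x v i ^ 2 ≤ (∑ j, contrastWeight x v j ^ 2) * (w x Q i ⬝ᵥ w x Q i) := by
  refine le_of_sq_le_sq ?_ (mul_nonneg (by positivity) (dotProduct_self_nonneg' _))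
  have h1 : (∑ j, contrastWeight x v j ^ 2) ^ 2 = ∑ l, lam l ^ 2 := by
    rw [← sum_Bmatrix_sq h.isUnit h.spectral]
    simp_rw [Bmatrix_vecMulVec, mul_pow, ← Finset.mul_sum, ← Finset.sum_mul]
    rw [sq]
  rw [mul_pow, h1, contrastWeight_sq]
  exact Bdiag_sq_le h.isUnit h.spectral i

lemma sum_contrastWeight_sq_le (h : RegularModel μ x β (vecMulVec v v) Q lam e y C c D η) :
    ∑ i, contrastWeight x v i ^ 2 ≤
      C * ∑ i, contrastWeight x v i ^ 2 * ∫ ω, e i ω ^ 2 ∂μ := by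
  rw [Finset.mul_sum]
  refine Finset.sum_le_sum fun i _ => ?_
  have : 1 ≤ C * ∫ ω, e i ω ^ 2 ∂μ := by
    calc (1 : ℝ) = C * C⁻¹ := (mul_inv_cancel₀ h.pos.ne').symm
      _ ≤ _ := mul_le_mul_of_nonneg_left (h.errors.inv_le_var i) h.pos.le
  nlinarith [sq_nonneg (contrastWeight x v i)]

lemma contrastVariance_pos (h : RegularModel μ x β (vecMulVec v v) Q lam e y C c D η)
    (hv : v ≠ 0) : 0 < ∑ i, contrastWeight x v i ^ 2 * ∫ ω, e i ω ^ 2 ∂μ :=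
  pos_of_mul_pos_right ((sum_contrastWeight_sq_pos h.isUnit hv).trans_le
    h.sum_contrastWeight_sq_le) h.pos.le

lemma contrastWeight_sq_div_le (h : RegularModel μ x β (vecMulVec v v) Q lam e y C c D η)
    (hv : v ≠ 0) (i : Fin n) :
    contrastWeight x v i ^ 2 / (∑ j, contrastWeight x v j ^ 2 * ∫ ω, e j ω ^ 2 ∂μ) ≤
      C * (w x Q i ⬝ᵥ w x Q i) := by
  rw [div_le_iff₀ (h.contrastVariance_pos hv)]
  refine (h.contrastWeight_sq_le i).trans ?_
  refine (mul_le_mul_of_nonneg_right h.sum_contrastWeight_sq_le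
    (dotProduct_self_nonneg' _)).trans_eq ?_
  ring

lemma sum_sq_contrastWeight_sq_div_le
    (h : RegularModel μ x β (vecMulVec v v) Q lam e y C c D η) (hv : v ≠ 0) :
    ∑ i, (contrastWeight x v i ^ 2 / (∑ j, contrastWeight x v j ^ 2 * ∫ ω, e j ω ^ 2 ∂μ)) ^ 2 ≤
      C ^ 2 * (η * r) := by
  refine le_trans ?_ (mul_le_mul_of_nonneg_left
    (sum_w_dotProduct_self_sq_le h.isUnit h.spectral.orthonormal h.weight_le) (sq_nonneg C))
  rw [Finset.mul_sum]
  refine Finset.sum_le_sum fun i _ => ?_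
  rw [← mul_pow]
  have := h.contrastVariance_pos hv
  exact pow_le_pow_left₀ (by positivity) (h.contrastWeight_sq_div_le hv i) 2

end RegularModel

end Contrast

/-! ### Chebyshev and Slutsky arguments -/

section Limits

variable {Ω : Type*} [MeasurableSpace Ω] {μ : Measure Ω} [IsProbabilityMeasure μ]

/-- Chebyshev's inequality, scaled so that it is meaningful also for `L = 0`. -/
lemma measure_lt_sq_le {R : Ω → ℝ} (hR : MemLp R 2 μ) {p q L : ℝ} (hL : 0 ≤ L) (hq : 0 < q)
    (h : ∫ ω, R ω ^ 2 ∂μ ≤ p * L) : μ {ω | q * L < R ω ^ 2} ≤ ENNReal.ofReal (p / q) := by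
  -- For L = 0 the second moment vanishes, so R = 0 almost surely and the strict inequality defines
  -- a null event.
  rcases hL.eq_or_lt with rfl | hL
  · rw [mul_zero] at h
    have h0 : ∫ ω, R ω ^ 2 ∂μ = 0 := le_antisymm h (integral_nonneg fun ω => sq_nonneg _)
    have hae := (integral_eq_zero_iff_of_nonneg (fun ω => sq_nonneg (R ω)) hR.integrable_sq).1 h0
    have : μ {ω | q * 0 < R ω ^ 2} = 0 := by
      refine measure_mono_null (fun ω hω => ?_) hae
      have h1 : q * 0 < R ω ^ 2 := hω
      rw [mul_zero] at h1
      exact h1.ne'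
    rw [this]
    exact zero_le
  · have hM := mul_meas_ge_le_integral_of_nonneg (ae_of_all _ fun ω => sq_nonneg (R ω))
      hR.integrable_sq (q * L)
    have hqL : 0 < q * L := mul_pos hq hL
    have h1 : μ.real {ω | q * L ≤ R ω ^ 2} ≤ p / q := by
      rw [le_div_iff₀ hq]
      have := hM.trans h
      nlinarith
    calc μ {ω | q * L < R ω ^ 2} ≤ μ {ω | q * L ≤ R ω ^ 2} :=
          measure_mono fun ω (hω : q * L < R ω ^ 2) => hω.le
      _ = ENNReal.ofReal (μ.real {ω | q * L ≤ R ω ^ 2}) := (ofReal_measureReal).symm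
      _ ≤ _ := ENNReal.ofReal_le_ofReal h1

lemma tendstoInMeasure_const_of_integral_sq_le {Z : ℕ → Ω → ℝ} {c : ℝ} {p : ℕ → ℝ}
    (hp : Tendsto p atTop (𝓝 0))
    (h : ∀ᶠ n in atTop, MemLp (fun ω => Z n ω - c) 2 μ ∧ ∫ ω, (Z n ω - c) ^ 2 ∂μ ≤ p n) :
    TendstoInMeasure μ Z atTop fun _ => c := by
  rw [tendstoInMeasure_iff_norm]
  intro δ hδ
  have hlim : Tendsto (fun n => ENNReal.ofReal (p n / (δ ^ 2 / 2))) atTop (𝓝 0) := by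
    have := ENNReal.tendsto_ofReal (hp.div_const (δ ^ 2 / 2))
    simpa using this
  refine tendsto_of_tendsto_of_tendsto_of_le_of_le' tendsto_const_nhds hlim
    (.of_forall fun _ => zero_le) ?_
  filter_upwards [h] with n ⟨h1, h2⟩
  refine le_trans (measure_mono fun ω (hω : δ ≤ ‖Z n ω - c‖) => ?_)
    -- Half of δ² turns the weak inequality of convergence in measure into a strict one.
    (measure_lt_sq_le h1 zero_le_one (q := δ ^ 2 / 2) (by positivity) (by rwa [mul_one]))
  show δ ^ 2 / 2 * 1 < (Z n ω - c) ^ 2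
  rw [Real.norm_eq_abs] at hω
  have : δ ^ 2 ≤ |Z n ω - c| ^ 2 := by gcongr
  rw [sq_abs] at this
  nlinarith [pow_pos hδ 2]

/-- Studentization: Slutsky's theorem for `X / √Y` with `Y → 1` in probability. -/
lemma tendstoInDistribution_div_sqrt {X Y Z : ℕ → Ω → ℝ} {ν : Measure ℝ}
    [IsProbabilityMeasure ν] (hX : TendstoInDistribution X atTop id (fun _ => μ) ν)
    (hY : TendstoInMeasure μ Y atTop fun _ => (1 : ℝ)) (hYm : ∀ n, AEMeasurable (Y n) μ)
    (hZm : ∀ n, AEMeasurable (Z n) μ)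
    (hZ : ∀ᶠ n in atTop, ∀ ω, 0 < Y n ω → Z n ω = X n ω / √(Y n ω)) :
    TendstoInDistribution Z atTop id (fun _ => μ) ν := by
  -- Truncating the denominator at 1/2 gives a globally continuous map. It agrees with the original
  -- ratio on |Y - 1| < 1/2, an event of probability tending to 1.
  have hcont : Continuous fun p : ℝ × ℝ => p.1 / √(max p.2 (1 / 2)) := by
    refine continuous_fst.div (by fun_prop) fun p => ?_
    have : (0 : ℝ) < max p.2 (1 / 2) := lt_max_of_lt_right (by norm_num)
    exact (Real.sqrt_pos.2 this).ne'
  have h1 := hX.continuous_comp_prodMk_of_tendstoInMeasure_const hcont hY hYm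
  have h2 : (fun t : ℝ => id t / √(max (1 : ℝ) (1 / 2))) = id := by
    funext t
    have : max (1 : ℝ) (1 / 2) = 1 := max_eq_left (by norm_num)
    rw [this]
    simp
  have h3 : TendstoInDistribution (fun n ω => X n ω / √(max (Y n ω) (1 / 2))) atTop id
      (fun _ => μ) ν := by
    rw [← h2]
    exact h1
  refine tendstoInDistribution_of_tendstoInMeasure_sub Z id h3 ?_ hZm
  rw [tendstoInMeasure_iff_norm] at hY ⊢
  intro δ hδ
  refine tendsto_of_tendsto_of_tendsto_of_le_of_le' tendsto_const_nhds (hY (1 / 2) (by norm_num))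
    (.of_forall fun _ => zero_le) ?_
  filter_upwards [hZ] with n hn
  refine measure_mono fun ω hω => ?_
  by_contra hc
  have hlt : |Y n ω - 1| < 1 / 2 := not_le.1 hc
  have hY2 : 1 / 2 < Y n ω := by linarith [(abs_lt.1 hlt).1]
  have hω' : δ ≤ ‖(Z n ω - X n ω / √(max (Y n ω) (1 / 2))) - 0‖ := hω
  rw [hn ω (by linarith), max_eq_left hY2.le, sub_self, sub_zero, norm_zero] at hω'
  linarith

end Limits

/-! ### Measurability of the estimators -/

section Measurability

variable {Ω : Type*} [MeasurableSpace Ω] {n k r : ℕ} {y : Ω → Fin n → ℝ}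

lemma measurable_bHat (x : Fin n → Fin k → ℝ) (Q : Matrix (Fin k) (Fin r) ℝ)
    (hy : ∀ i, Measurable fun ω => y ω i) : Measurable fun ω => bHat x Q (y ω) := by
  unfold bHat
  fun_prop

lemma measurable_betaHat (x : Fin n → Fin k → ℝ) (hy : ∀ i, Measurable fun ω => y ω i) :
    Measurable fun ω => betaHat x (y ω) := by
  unfold betaHat
  refine (Continuous.matrix_mulVec continuous_const continuous_id).measurable.comp ?_
  exact Finset.measurable_fun_sum _ fun i _ => (hy i).smul_const (x i)

lemma measurable_sigmaSqHat (x : Fin n → Fin k → ℝ) (hy : ∀ i, Measurable fun ω => y ω i)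
    (i : Fin n) : Measurable fun ω => sigmaSqHat x (y ω) i := by
  have h : Measurable fun ω => betaHatLeaveOut x (y ω) i := by
    unfold betaHatLeaveOut
    refine (Continuous.matrix_mulVec continuous_const continuous_id).measurable.comp ?_
    exact Finset.measurable_fun_sum _ fun l _ => (hy l).smul_const (x l)
  have h2 : Measurable fun ω => x i ⬝ᵥ betaHatLeaveOut x (y ω) i :=
    (Continuous.dotProduct continuous_const continuous_id).measurable.comp h
  exact (hy i).mul ((hy i).sub h2)

end Measurability

end LeaveOut

end

/-! ### Assembly of the limit statements -/

theorem theorem1 {Ω : Type*} [MeasurableSpace Ω] (μ : Measure Ω) [IsProbabilityMeasure μ]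
    (r : ℕ) (k : ℕ → ℕ)
    (x : ∀ n, Fin n → Fin (k n) → ℝ) (β : ∀ n, Fin (k n) → ℝ)
    (A : ∀ n, Matrix (Fin (k n)) (Fin (k n)) ℝ)
    (Q : ∀ n, Matrix (Fin (k n)) (Fin r) ℝ) (lam : ℕ → Fin r → ℝ)
    (ε : ∀ n, Fin n → Ω → ℝ) (y : ∀ n, Ω → Fin n → ℝ)
    -- the linear model, with independent mean zero errors
    (hε : ∀ n i, Measurable (ε n i))
    (hy : ∀ n ω i, y n ω i = x n i ⬝ᵥ β n + ε n i ω)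
    (hindep : ∀ᶠ n in atTop, iIndepFun (ε n) μ)
    (hmean : ∀ᶠ n in atTop, ∀ i, ∫ ω, ε n i ω ∂μ = 0)
    -- the design has full rank, `A` is symmetric of rank `r`
    (hS : ∀ᶠ n in atTop, IsUnit (LeaveOut.Sxx (x n)))
    (hA : ∀ᶠ n in atTop, (A n).IsSymm ∧ (A n).rank = r)
    (hQ : ∀ᶠ n in atTop,
      LeaveOut.IsSpectralDecomposition (LeaveOut.Atilde (x n) (A n)) (Q n) (lam n))
    -- bounded fourth moments, error variances positive and bounded away from zero
    (hmoment : ∃ C : ℝ, ∀ᶠ n in atTop, ∀ i,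
      Integrable (fun ω => ε n i ω ^ 4) μ ∧ 0 < ∫ ω, ε n i ω ^ 2 ∂μ ∧
        ∫ ω, ε n i ω ^ 4 ∂μ + (∫ ω, ε n i ω ^ 2 ∂μ)⁻¹ ≤ C)
    -- leverages bounded below one
    (hlev : ∃ c : ℝ, c < 1 ∧ ∀ᶠ n in atTop, ∀ i, LeaveOut.leverage (x n) i ≤ c)
    -- bounded mean function
    (hsignal : ∃ C : ℝ, ∀ᶠ n in atTop, ∀ i, (x n i ⬝ᵥ β n) ^ 2 ≤ C)
    -- Lindeberg condition
    (hw : Tendsto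
      (fun n => ⨆ i, LeaveOut.w (x n) (Q n) i ⬝ᵥ LeaveOut.w (x n) (Q n) i) atTop (𝓝 0)) :
    -- asymptotic normality of `V[b̂]^{-1/2} (b̂ - b)`
    TendstoInDistribution
      (fun n ω => WithLp.toLp 2
        ((CFC.sqrt (LeaveOut.varMatrix μ fun ω' => LeaveOut.bHat (x n) (Q n) (y n ω')))⁻¹ *ᵥ
          (LeaveOut.bHat (x n) (Q n) (y n ω) - LeaveOut.b (x n) (Q n) (β n))))
      atTop id (fun _ => μ) (stdGaussian (EuclideanSpace ℝ (Fin r))) ∧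
    -- consistency of the leave-out variance estimator
    (∀ l m : Fin r, TendstoInMeasure μ
      (fun n ω => ((LeaveOut.varMatrix μ fun ω' => LeaveOut.bHat (x n) (Q n) (y n ω'))⁻¹ *
        LeaveOut.varHatB (x n) (Q n) (y n ω)) l m)
      atTop (fun _ => (1 : Matrix (Fin r) (Fin r) ℝ) l m)) ∧
    -- the remainder in the representation of `θ̂` is `o_p(V[θ̂]^{1/2})`
    (∀ δ : ℝ, 0 < δ → Tendsto
      (fun n => μ {ω |
        δ * Real.sqrt (Var[fun ω' => LeaveOut.thetaHat (x n) (A n) (y n ω'); μ]) <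
          |LeaveOut.thetaHat (x n) (A n) (y n ω) -
            ∑ l, lam n l * (LeaveOut.bHat (x n) (Q n) (y n ω) l ^ 2 -
              Var[fun ω' => LeaveOut.bHat (x n) (Q n) (y n ω') l; μ])|})
      atTop (𝓝 0)) ∧
    -- inference on a linear contrast `v'β`, the case `A = v v'`
    (∀ v : ∀ n, Fin (k n) → ℝ,
      (∀ᶠ n in atTop, v n ≠ 0 ∧ A n = vecMulVec (v n) (v n)) →
      TendstoInDistribution
        (fun n ω => (v n ⬝ᵥ (LeaveOut.betaHat (x n) (y n ω) - β n)) /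
          Real.sqrt (v n ⬝ᵥ (LeaveOut.varHatBeta (x n) (y n ω) *ᵥ v n)))
        atTop id (fun _ => μ) (gaussianReal 0 1)) := by
  obtain ⟨C₀, hC₀⟩ := hmoment
  obtain ⟨c, hc1, hc⟩ := hlev
  obtain ⟨D₀, hD₀⟩ := hsignal
  set C : ℝ := max C₀ 1 with hC
  set D : ℝ := max D₀ 0 with hD
  set η : ℕ → ℝ := fun n =>
    ⨆ i, LeaveOut.w (x n) (Q n) i ⬝ᵥ LeaveOut.w (x n) (Q n) i with hη
  have hCpos : 0 < C := lt_max_of_lt_right one_pos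
  have hreg : ∀ᶠ n in atTop, LeaveOut.RegularModel μ (x n) (β n) (A n) (Q n) (lam n) (ε n) (y n)
      C c D (η n) := by
    filter_upwards [hindep, hmean, hS, hA, hQ, hC₀, hc, hD₀] with n h1 h2 h3 h4 h5 h6 h7 h8
    exact
      { errors :=
          { measurable := hε n
            indep := h1
            mean := h2
            integrable := fun i => (h6 i).1
            var_pos := fun i => (h6 i).2.1
            bound := fun i => (h6 i).2.2.trans (le_max_left _ _) }
        pos := hCpos
        model := hy n
        isUnit := h3
        isSymm := h4.1
        spectral := h5
        lt_one := hc1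
        leverage_le := h7
        signal_le := fun i => (h8 i).trans (le_max_left _ _)
        weight_le := fun i => le_ciSup
          (f := fun i => LeaveOut.w (x n) (Q n) i ⬝ᵥ LeaveOut.w (x n) (Q n) i)
          (Set.finite_range _).bddAbove i }
  have hM : 0 ≤ LeaveOut.momentConst C c D :=
    LeaveOut.momentConst_nonneg hCpos (le_max_right _ _)
  have herr : ∀ᶠ n in atTop, LeaveOut.ErrorBounds μ (ε n) C := hreg.mono fun n h => h.errors
  have hsqrt : Tendsto (fun n => √(C * η n)) atTop (𝓝 0) := by
    have := (hw.const_mul C).sqrt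
    simpa using this
  have hym : ∀ n i, Measurable fun ω => y n ω i := fun n i => by
    simp_rw [hy]
    exact (hε n i).const_add _
  refine ⟨?_, ?_, ?_, ?_⟩
  · refine LeaveOut.tendstoInDistribution_of_inner_eq_linear
      (a := fun n t i => ((CFC.sqrt (LeaveOut.varMatrix μ fun ω' =>
        LeaveOut.bHat (x n) (Q n) (y n ω')))⁻¹ *ᵥ t.ofLp) ⬝ᵥ LeaveOut.w (x n) (Q n) i)
      charFun_stdGaussian (fun n => ?_) herr hsqrt ?_
    · refine Measurable.aemeasurable ?_
      refine (WithLp.measurable_toLp 2 _).comp ?_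
      exact (Continuous.matrix_mulVec continuous_const continuous_id).measurable.comp
        ((LeaveOut.measurable_bHat (x n) (Q n) (hym n)).sub_const _)
    · filter_upwards [hreg] with n h
      exact h.inner_standardized
  · intro l m
    have hp : Tendsto (fun n => LeaveOut.momentConst C c D * (C ^ 2 * (η n * r))) atTop
        (𝓝 0) := by
      have := ((hw.mul_const (r : ℝ)).const_mul (C ^ 2)).const_mul (LeaveOut.momentConst C c D)
      simpa using this
    refine LeaveOut.tendstoInMeasure_const_of_integral_sq_le hp ?_
    filter_upwards [hreg] with n h
    simp_rw [h.inv_varMatrix_mul_varHatB_sub]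
    refine ⟨(h.integral_sum_sigmaSqHat_sub_sq_le _).1,
      (h.integral_sum_sigmaSqHat_sub_sq_le _).2.trans ?_⟩
    exact mul_le_mul_of_nonneg_left (h.sum_weight_sq_le l m) hM
  · intro δ hδ
    set M : ℝ := LeaveOut.momentConst C c D
    -- Chosen so that δ² V[θ̂] ≥ q ∑ λ², given that V[θ̂] ≥ (C⁻²/2) ∑ λ².
    set q : ℝ := δ ^ 2 * ((C⁻¹) ^ 2 / 2) with hq
    have hqpos : 0 < q := by positivity
    have hlim : Tendsto (fun n => ENNReal.ofReal (M * (η n * r) / q)) atTop (𝓝 0) := by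
      have := ENNReal.tendsto_ofReal (((hw.mul_const (r : ℝ)).const_mul M).div_const q)
      simpa using this
    -- Eventually the diagonal of B costs at most half of the leading term C⁻² ∑ λ² in the lower
    -- bound for V[θ̂].
    have hsmall : ∀ᶠ n in atTop,
        ((C⁻¹) ^ 2 + 2 * (1 + C) ^ 2 * ((1 - c)⁻¹) ^ 2) * (η n * r) < (C⁻¹) ^ 2 / 2 := by
      have h0 : Tendsto (fun n => ((C⁻¹) ^ 2 + 2 * (1 + C) ^ 2 * ((1 - c)⁻¹) ^ 2) * (η n * r))
          atTop (𝓝 0) := by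
        have := (hw.mul_const (r : ℝ)).const_mul
          ((C⁻¹) ^ 2 + 2 * (1 + C) ^ 2 * ((1 - c)⁻¹) ^ 2)
        simpa using this
      exact h0.eventually (gt_mem_nhds (by positivity))
    refine tendsto_of_tendsto_of_tendsto_of_le_of_le' tendsto_const_nhds hlim
      (.of_forall fun _ => zero_le) ?_
    filter_upwards [hreg, hsmall] with n h hs
    set L : ℝ := ∑ l, lam n l ^ 2
    have hL : 0 ≤ L := by positivity
    have hB := LeaveOut.sum_Bdiag_sq_le h.isUnit h.spectral h.weight_le
    have hV : (C⁻¹) ^ 2 / 2 * L ≤ Var[fun ω => LeaveOut.thetaHat (x n) (A n) (y n ω); μ] := by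
      refine le_trans ?_ h.le_variance_thetaHat
      have h1 : ((C⁻¹) ^ 2 + 2 * (1 + C) ^ 2 * ((1 - c)⁻¹) ^ 2) *
          ∑ i, LeaveOut.Bdiag (x n) (A n) i ^ 2 ≤
          ((C⁻¹) ^ 2 + 2 * (1 + C) ^ 2 * ((1 - c)⁻¹) ^ 2) * (L * (η n * r)) := by gcongr
      have h2 := mul_le_mul_of_nonneg_right hs.le hL
      linarith
    obtain ⟨hmem, hint⟩ :=
      h.integral_sum_sigmaSqHat_sub_sq_le fun i => LeaveOut.Bdiag (x n) (A n) i
    have hint' := hint.trans (mul_le_mul_of_nonneg_left hB hM)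
    refine le_trans (measure_mono fun ω hω => ?_)
      (LeaveOut.measure_lt_sq_le hmem hL hqpos (hint'.trans_eq (by ring)))
    simp only [Set.mem_ofPred_eq] at hω ⊢
    rw [h.thetaHat_sub, abs_neg] at hω
    have h3 := pow_lt_pow_left₀ hω (by positivity) two_ne_zero
    rw [mul_pow, Real.sq_sqrt (variance_nonneg _ _), sq_abs] at h3
    refine lt_of_le_of_lt ?_ h3
    rw [hq, mul_assoc]
    exact mul_le_mul_of_nonneg_left hV (sq_nonneg δ)
  · intro v hv
    have hreg' : ∀ᶠ n in atTop, v n ≠ 0 ∧ LeaveOut.RegularModel μ (x n) (β n)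
        (vecMulVec (v n) (v n)) (Q n) (lam n) (ε n) (y n) C c D (η n) := by
      filter_upwards [hreg, hv] with n h ⟨hv0, hA'⟩
      exact ⟨hv0, hA' ▸ h⟩
    set a : ∀ n, Fin n → ℝ := fun n => LeaveOut.contrastWeight (x n) (v n)
    set τ : ℕ → ℝ := fun n => ∑ i, a n i ^ 2 * ∫ ω, ε n i ω ^ 2 ∂μ
    have hβm : ∀ n, Measurable fun ω => v n ⬝ᵥ (LeaveOut.betaHat (x n) (y n ω) - β n) :=
      fun n => (Continuous.dotProduct continuous_const continuous_id).measurable.comp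
        ((LeaveOut.measurable_betaHat (x n) (hym n)).sub_const _)
    have hVm : ∀ n, Measurable fun ω =>
        v n ⬝ᵥ (LeaveOut.varHatBeta (x n) (y n ω) *ᵥ v n) := fun n => by
      simp_rw [LeaveOut.dotProduct_varHatBeta]
      exact Finset.measurable_fun_sum _ fun i _ =>
        (LeaveOut.measurable_sigmaSqHat (x n) (hym n) i).const_mul _
    have hX : TendstoInDistribution
        (fun n ω => v n ⬝ᵥ (LeaveOut.betaHat (x n) (y n ω) - β n) / √(τ n))
        atTop id (fun _ => μ) (gaussianReal 0 1) := by
      -- The same limit theorem, now on ℝ, normalizing by the true variance τ; the estimated one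
      -- enters only through Slutsky's theorem.
      refine LeaveOut.tendstoInDistribution_of_inner_eq_linear
        (a := fun n t i => t * (a n i / √(τ n))) (fun t => ?_)
        (fun n => ((hβm n).div_const _).aemeasurable) herr hsqrt ?_
      · have habs : ((|t| : ℝ) : ℂ) ^ 2 = (t : ℂ) ^ 2 := by
          rw [← Complex.ofReal_pow, sq_abs, Complex.ofReal_pow]
        rw [charFun_gaussianReal, Real.norm_eq_abs, habs]
        congr 1
        push_cast
        ring
      · filter_upwards [hreg'] with n ⟨hv0, h⟩ t
        have hτ : 0 < τ n := h.contrastVariance_pos hv0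
        refine ⟨fun ω => ?_, ?_, fun i => ?_⟩
        · rw [h.dotProduct_betaHat_sub, Finset.sum_div]
          simp only [RCLike.inner_apply, conj_trivial, Finset.mul_sum]
          exact Finset.sum_congr rfl fun i _ => by ring
        · have h1 : ∀ i, (t * (a n i / √(τ n))) ^ 2 * ∫ ω, ε n i ω ^ 2 ∂μ =
              t ^ 2 / τ n * (a n i ^ 2 * ∫ ω, ε n i ω ^ 2 ∂μ) := fun i => by
            rw [mul_pow, div_pow, Real.sq_sqrt hτ.le]
            ring
          simp_rw [h1, ← Finset.mul_sum]
          rw [Real.norm_eq_abs, sq_abs]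
          exact div_mul_cancel₀ _ hτ.ne'
        · rw [abs_mul, Real.norm_eq_abs]
          refine mul_le_mul_of_nonneg_left (Real.abs_le_sqrt ?_) (abs_nonneg t)
          rw [div_pow, Real.sq_sqrt hτ.le]
          exact (h.contrastWeight_sq_div_le hv0 i).trans
            (mul_le_mul_of_nonneg_left (h.weight_le i) hCpos.le)
    have hY : TendstoInMeasure μ
        (fun n ω => v n ⬝ᵥ (LeaveOut.varHatBeta (x n) (y n ω) *ᵥ v n) / τ n) atTop
        fun _ => (1 : ℝ) := by
      have hp : Tendsto (fun n => LeaveOut.momentConst C c D * (C ^ 2 * (η n * r))) atTop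
          (𝓝 0) := by
        have := ((hw.mul_const (r : ℝ)).const_mul (C ^ 2)).const_mul
          (LeaveOut.momentConst C c D)
        simpa using this
      refine LeaveOut.tendstoInMeasure_const_of_integral_sq_le hp ?_
      filter_upwards [hreg'] with n ⟨hv0, h⟩
      have hτ : 0 < τ n := h.contrastVariance_pos hv0
      have h1 : ∀ ω, v n ⬝ᵥ (LeaveOut.varHatBeta (x n) (y n ω) *ᵥ v n) / τ n - 1 =
          ∑ i, a n i ^ 2 / τ n *
            (LeaveOut.sigmaSqHat (x n) (y n ω) i - ∫ ω', ε n i ω' ^ 2 ∂μ) := fun ω => by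
        rw [LeaveOut.dotProduct_varHatBeta, ← div_self hτ.ne', ← sub_div, ← Finset.sum_sub_distrib,
          Finset.sum_div]
        exact Finset.sum_congr rfl fun i _ => by ring
      simp_rw [h1]
      exact ⟨(h.integral_sum_sigmaSqHat_sub_sq_le _).1,
        (h.integral_sum_sigmaSqHat_sub_sq_le _).2.trans
          (mul_le_mul_of_nonneg_left (h.sum_sq_contrastWeight_sq_div_le hv0) hM)⟩
    refine LeaveOut.tendstoInDistribution_div_sqrt hX hY
      (fun n => ((hVm n).div_const _).aemeasurable)
      (fun n => ((hβm n).div (hVm n).sqrt).aemeasurable) ?_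
    filter_upwards [hreg'] with n ⟨hv0, h⟩ ω _
    have hτ : 0 < τ n := h.contrastVariance_pos hv0
    rw [Real.sqrt_div' _ hτ.le, div_div_div_cancel_right₀ (Real.sqrt_pos.2 hτ).ne']
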